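/- Let $\Bbbk$ be a field of characteristic zero and let $A=\Bbbk\langle x,y\rangle/(x^2,\;y^2x-xy^2-xyx)$ be the super Jordan plane. Let $$HH^1(A,A)=\ker d^1/\operatorname{im}d^0,\qquad (d^0a)(b)=ba-ab,\qquad (d^1f)(a,b)=af(b)-f(ab)+f(a)b,$$ be the first Hochschild cohomology of $A$, with the Lie bracket induced by the Gerstenhaber bracket $[f,g]=f\circ g-g\circ f$ of $1$-cochains $f,g\in\operatorname{Hom}_\Bbbk(A,A)$. Let $\mathrm{Vir}$ be the Virasoro algebra over $\Bbbk$: the Lie algebra with basis $\{C\}\cup\{L_n : n\in\mathbb Z\}$ and brackets $$[L_m,C]=0,\qquad [L_m,L_n]=(n-m)L_{m+n}+\delta_{m,-n}\,\frac{m^3-m}{12}\,C .$$ Put $\mathrm{Vir}^+=\bigoplus_{n\ge1}\Bbbk L_n$ and $\mathfrak h=\Bbbk C\oplus\Bbbk L_0$, so that $\mathrm{Vir}^+\oplus\mathfrak h$ is a Lie subalgebra of $\mathrm{Vir}$. There is a unique Hochschild $1$-cocycle $c$ of $A$ with $c(x)=0$, $c(y)=x$, and for each $n\ge0$ a unique Hochschild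 $1$-cocycle $s_n$ with $s_n(x)=(2n+1)\,xy^{2n}$, $s_n(y)=y^{2n+1}$. Writing $c$ and $s_n$ also for their classes in $HH^1(A,A)$: 1. $c$ is central in the Lie algebra $HH^1(A,A)$; 2. $[s_m,s_n]=2(n-m)\,s_{n+m}$ for all $m,n\ge0$; 3. there is an isomorphism of Lie algebras $HH^1(A,A)\cong\mathrm{Vir}^+\oplus\mathfrak h$ with $c\mapsto C$ and $s_m\mapsto 2^{m+1}L_m$ for all $m\ge0$. -/

import Mathlib

/-! ### First Hochschild cohomology of an associative algebra, as a Lie algebra -/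

namespace Hochschild

section General

attribute [local instance 100] LieRing.ofAssociativeRing

variable (k : Type*) (A : Type*) [CommRing k] [Ring A] [Algebra k A]

/-- The Hochschild differential `C⁰(A, A) = A → C¹(A, A) = Hom_k(A, A)`,
`(d⁰ a)(b) = b a - a b`. -/
def d0 : A →ₗ[k] Module.End k A :=
  (LinearMap.mul k A).flip - LinearMap.mul k A

@[simp]
theorem d0_apply (a b : A) : d0 k A a b = b * a - a * b := rfl

/-- The Hochschild differential `C¹(A, A) = Hom_k(A, A) → C²(A, A)`, where `C²(A, A)` is the space
of bilinear maps `A × A → A`: `(d¹ f)(a, b) = a f(b) - f(a b) + f(a) b`. -/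
def d1 : Module.End k A →ₗ[k] A →ₗ[k] A →ₗ[k] A where
  toFun f := LinearMap.mk₂ k (fun a b => a * f b - f (a * b) + f a * b)
    (fun a a' b => by simp only [add_mul, map_add]; abel)
    (fun r a b => by simp only [smul_mul_assoc, map_smul, smul_add, smul_sub])
    (fun a b b' => by simp only [mul_add, map_add]; abel)
    (fun r a b => by simp only [mul_smul_comm, map_smul, smul_add, smul_sub])
  map_add' f g := by
    ext a b
    simp only [LinearMap.mk₂_apply, LinearMap.add_apply, mul_add, add_mul]
    abel
  map_smul' r f := by
    ext a b
    simp only [LinearMap.mk₂_apply, LinearMap.smul_apply, mul_smul_comm, smul_mul_assoc,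
      smul_add, smul_sub, RingHom.id_apply]

@[simp]
theorem d1_apply (f : Module.End k A) (a b : A) :
    d1 k A f a b = a * f b - f (a * b) + f a * b := rfl

variable {k A} in
theorem mem_ker_d1 {f : Module.End k A} :
    f ∈ LinearMap.ker (d1 k A) ↔ ∀ a b, f (a * b) = a * f b + f a * b := by
  rw [LinearMap.mem_ker]
  constructor
  · intro h a b
    have h2 : a * f b - f (a * b) + f a * b = 0 := by
      rw [← d1_apply, h]; rfl
    rw [sub_add_eq_add_sub, sub_eq_zero] at h2
    exact h2.symm
  · intro h
    ext a b
    simp [h a b]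

/-- The space of Hochschild `1`-cocycles, a Lie algebra under the Gerstenhaber bracket of
`1`-cochains `⁅f, g⁆ = f ∘ g - g ∘ f` (the commutator bracket of the ring `Module.End k A`). -/
def Z1 : LieSubalgebra k (Module.End k A) :=
  { LinearMap.ker (d1 k A) with
    lie_mem' := by
      intro f g hf hg
      have hf' := mem_ker_d1.1 hf
      have hg' := mem_ker_d1.1 hg
      refine mem_ker_d1.2 fun a b => ?_
      simp only [LieRing.of_associative_ring_bracket, LinearMap.sub_apply, Module.End.mul_apply,
        hf', hg', map_add, mul_sub, sub_mul]
      abel }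

variable {k A} in
theorem mem_Z1 {f : Module.End k A} :
    f ∈ Z1 k A ↔ ∀ a b, f (a * b) = a * f b + f a * b := mem_ker_d1

theorem Z1_lie_apply (f g : Z1 k A) (a : A) :
    (⁅f, g⁆ : Z1 k A).1 a = f.1 (g.1 a) - g.1 (f.1 a) := rfl

/-- The Hochschild `1`-coboundaries, the image of `d⁰`, form a Lie ideal of the `1`-cocycles. -/
def B1 : LieIdeal k (Z1 k A) :=
  { (LinearMap.range (d0 k A)).comap (Z1 k A).toSubmodule.subtype with
    lie_mem := by
      rintro ⟨f, hf⟩ ⟨g, hg⟩ ⟨a, ha⟩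
      have hf' := mem_Z1.1 hf
      refine ⟨f a, ?_⟩
      change d0 k A a = g at ha
      subst ha
      change d0 k A (f a) = ⁅f, d0 k A a⁆
      ext b
      simp only [LieRing.of_associative_ring_bracket, LinearMap.sub_apply, Module.End.mul_apply,
        d0_apply, map_sub, hf']
      abel }

theorem mem_B1 {f : Z1 k A} : f ∈ B1 k A ↔ ∃ a, d0 k A a = (f : Module.End k A) := Iff.rfl

/-- Every `1`-coboundary is a `1`-cocycle. -/
theorem d0_mem_Z1 (a : A) : d0 k A a ∈ Z1 k A := by
  refine mem_Z1.2 fun b c => ?_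
  simp only [d0_apply, mul_sub, sub_mul, mul_assoc]
  abel

/-- The first Hochschild cohomology `HH¹(A, A) = ker d¹ / im d⁰`, with the Lie algebra structure
induced by the Gerstenhaber bracket. -/
abbrev HH1 : Type _ := Z1 k A ⧸ B1 k A

variable {k A} in
/-- The cohomology class of a Hochschild `1`-cocycle. -/
abbrev HH1.mk (f : Z1 k A) : HH1 k A := LieSubmodule.Quotient.mk f

variable {k A} in
theorem HH1.mk_lie_mk (f g : Z1 k A) : ⁅HH1.mk f, HH1.mk g⁆ = HH1.mk ⁅f, g⁆ := rfl

variable {k A} in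
theorem HH1.mk_eq_zero {f : Z1 k A} :
    HH1.mk f = 0 ↔ ∃ a, d0 k A a = (f : Module.End k A) :=
  LieSubmodule.Quotient.mk_eq_zero'.trans Iff.rfl

end General

end Hochschild

/-! ### The super Jordan plane -/

namespace SuperJordanPlane

/-- The defining relations `x² = 0` and `y²x = xy² + xyx`, where `x` and `y` are the generators
of index `0` and `1` of the free algebra. -/
inductive Rel (k : Type*) [Field k] : FreeAlgebra k (Fin 2) → FreeAlgebra k (Fin 2) → Prop
  | sq : Rel k (FreeAlgebra.ι k 0 ^ 2) 0
  | cubic : Rel k (FreeAlgebra.ι k 1 ^ 2 * FreeAlgebra.ι k 0)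
      (FreeAlgebra.ι k 0 * FreeAlgebra.ι k 1 ^ 2
        + FreeAlgebra.ι k 0 * FreeAlgebra.ι k 1 * FreeAlgebra.ι k 0)

end SuperJordanPlane

/-- The super Jordan plane `k⟨x, y⟩ / (x², y²x - xy² - xyx)`. -/
abbrev SuperJordanPlane (k : Type*) [Field k] : Type _ := RingQuot (SuperJordanPlane.Rel k)

namespace SuperJordanPlane

variable (k : Type*) [Field k]

/-- The generator `x` of the super Jordan plane. -/
def x : SuperJordanPlane k := RingQuot.mkAlgHom k (Rel k) (FreeAlgebra.ι k 0)

/-- The generator `y` of the super Jordan plane. -/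
def y : SuperJordanPlane k := RingQuot.mkAlgHom k (Rel k) (FreeAlgebra.ι k 1)

end SuperJordanPlane

/-! ### The Virasoro algebra -/

/-- The underlying vector space of the Virasoro algebra: the pair `(u, z)` stands for the element
`∑ₙ uₙ Lₙ + z C`. -/
def Virasoro (k : Type*) [Field k] : Type _ := (ℤ →₀ k) × k

namespace Virasoro

section Structure

variable (k : Type*) [Field k]

noncomputable instance : AddCommGroup (Virasoro k) := inferInstanceAs (AddCommGroup ((ℤ →₀ k) × k))

noncomputable instance : Module k (Virasoro k) := inferInstanceAs (Module k ((ℤ →₀ k) × k))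

/-- The basis element `Lₙ`. -/
noncomputable def L (n : ℤ) : Virasoro k := (Finsupp.single n 1, 0)

/-- The central charge `C`. -/
def C : Virasoro k := (0, 1)

/-- The bilinear bracket of the Witt algebra, `(Lₘ, Lₙ) ↦ (n - m) Lₘ₊ₙ`. -/
noncomputable def wittBracket : (ℤ →₀ k) →ₗ[k] (ℤ →₀ k) →ₗ[k] (ℤ →₀ k) :=
  Finsupp.linearCombination k fun m : ℤ =>
    Finsupp.linearCombination k fun n : ℤ => Finsupp.single (m + n) ((n : k) - (m : k))

/-- The bilinear form `(Lₘ, Lₙ) ↦ δ_{m,-n} (m³ - m) / 12`. -/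
noncomputable def cocycle : (ℤ →₀ k) →ₗ[k] (ℤ →₀ k) →ₗ[k] k :=
  Finsupp.linearCombination k fun m : ℤ =>
    Finsupp.linearCombination k fun n : ℤ => if m = -n then ((m : k) ^ 3 - (m : k)) / 12 else 0

variable {k}

theorem wittBracket_single (m n : ℤ) (a b : k) :
    wittBracket k (Finsupp.single m a) (Finsupp.single n b)
      = Finsupp.single (m + n) (a * b * ((n : k) - (m : k))) := by
  simp only [wittBracket, Finsupp.linearCombination_single, LinearMap.smul_apply,
    Finsupp.smul_single, smul_eq_mul, mul_assoc]

theorem cocycle_single (m n : ℤ) (a b : k) :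
    cocycle k (Finsupp.single m a) (Finsupp.single n b)
      = if m = -n then a * b * (((m : k) ^ 3 - (m : k)) / 12) else 0 := by
  simp [cocycle, mul_assoc]

theorem wittBracket_skew (u v : ℤ →₀ k) : wittBracket k u v = -wittBracket k v u := by
  induction u using Finsupp.induction_linear with
  | zero => simp
  | add f g hf hg => simp [hf, hg, add_comm]
  | single m a =>
    induction v using Finsupp.induction_linear with
    | zero => simp
    | add f g hf hg => simp [hf, hg, add_comm]
    | single n b =>
      rw [wittBracket_single, wittBracket_single, add_comm n m, ← Finsupp.single_neg]
      congr 1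
      ring

theorem cocycle_skew (u v : ℤ →₀ k) : cocycle k u v = -cocycle k v u := by
  induction u using Finsupp.induction_linear with
  | zero => simp
  | add f g hf hg => simp [hf, hg, add_comm]
  | single m a =>
    induction v using Finsupp.induction_linear with
    | zero => simp
    | add f g hf hg => simp [hf, hg, add_comm]
    | single n b =>
      rw [cocycle_single, cocycle_single]
      by_cases h : m = -n
      · subst h
        simp
        ring
      · rw [if_neg h, if_neg (by omega), neg_zero]

theorem wittBracket_leibniz (u v w : ℤ →₀ k) :
    wittBracket k u (wittBracket k v w)
      = wittBracket k (wittBracket k u v) w + wittBracket k v (wittBracket k u w) := by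
  induction u using Finsupp.induction_linear with
  | zero => simp
  | add f g hf hg => simp only [map_add, LinearMap.add_apply, hf, hg]; abel
  | single m a =>
    induction v using Finsupp.induction_linear with
    | zero => simp
    | add f g hf hg => simp only [map_add, LinearMap.add_apply, hf, hg]; abel
    | single n b =>
      induction w using Finsupp.induction_linear with
      | zero => simp
      | add f g hf hg => simp only [map_add, hf, hg]; abel
      | single p c =>
        simp only [wittBracket_single]
        rw [show m + n + p = m + (n + p) by ring, show n + (m + p) = m + (n + p) by ring,
          ← Finsupp.single_add]
        congr 1
        push_cast
        ring

theorem cocycle_leibniz (u v w : ℤ →₀ k) :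
    cocycle k u (wittBracket k v w)
      = cocycle k (wittBracket k u v) w + cocycle k v (wittBracket k u w) := by
  induction u using Finsupp.induction_linear with
  | zero => simp
  | add f g hf hg => simp only [map_add, LinearMap.add_apply, hf, hg]; abel
  | single m a =>
    induction v using Finsupp.induction_linear with
    | zero => simp
    | add f g hf hg => simp only [map_add, LinearMap.add_apply, hf, hg]; abel
    | single n b =>
      induction w using Finsupp.induction_linear with
      | zero => simp
      | add f g hf hg => simp only [map_add, hf, hg]; abel
      | single p c =>
        simp only [wittBracket_single, cocycle_single]
        by_cases h : m + n + p = 0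
        · rw [if_pos (by omega), if_pos (by omega), if_pos (by omega)]
          obtain rfl : p = -m - n := by omega
          push_cast
          ring
        · rw [if_neg (by omega), if_neg (by omega), if_neg (by omega), add_zero]

section Parts

variable (k)

/-- The positive part `Vir⁺ = ⨁_{n ≥ 1} k Lₙ`. -/
noncomputable def positivePart : Submodule k (Virasoro k) :=
  Submodule.span k {u | ∃ n : ℤ, 1 ≤ n ∧ u = L k n}

/-- The Cartan subalgebra `𝔥 = k C ⊕ k L₀`. -/
noncomputable def cartan : Submodule k (Virasoro k) :=
  Submodule.span k {C k, L k 0}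

theorem L_mem {n : ℤ} (hn : 0 ≤ n) : L k n ∈ positivePart k ⊔ cartan k := by
  rcases hn.eq_or_lt with rfl | h
  · exact Submodule.mem_sup_right (Submodule.subset_span (by simp))
  · exact Submodule.mem_sup_left (Submodule.subset_span ⟨n, h, rfl⟩)

theorem C_mem : C k ∈ positivePart k ⊔ cartan k :=
  Submodule.mem_sup_right (Submodule.subset_span (by simp))

theorem sup_eq_span : positivePart k ⊔ cartan k
    = Submodule.span k {u | u = C k ∨ ∃ n : ℤ, 0 ≤ n ∧ u = L k n} := by
  apply le_antisymm
  · refine sup_le (Submodule.span_mono ?_) (Submodule.span_mono ?_)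
    · rintro u ⟨n, hn, rfl⟩
      exact Or.inr ⟨n, by omega, rfl⟩
    · rintro u (rfl | rfl)
      · exact Or.inl rfl
      · exact Or.inr ⟨0, le_rfl, rfl⟩
  · refine Submodule.span_le.2 ?_
    rintro u (rfl | ⟨n, hn, rfl⟩)
    · exact C_mem k
    · exact L_mem k hn

/-- The sum of `Vir⁺` and `𝔥` inside the Virasoro algebra is direct. -/
theorem disjoint_positivePart_cartan : Disjoint (positivePart k) (cartan k) := by
  rw [Submodule.disjoint_def]
  intro u hu hv
  have h1 : u.1 0 = 0 ∧ u.2 = 0 := by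
    clear hv
    induction hu using Submodule.span_induction with
    | mem u hu =>
      obtain ⟨n, hn, rfl⟩ := hu
      exact ⟨Finsupp.single_eq_of_ne (by omega), rfl⟩
    | zero => exact ⟨rfl, rfl⟩
    | add u v _ _ hu hv =>
      exact ⟨(congrArg₂ (· + ·) hu.1 hv.1).trans (add_zero 0),
        (congrArg₂ (· + ·) hu.2 hv.2).trans (add_zero 0)⟩
    | smul t u _ hu =>
      exact ⟨(congrArg (t * ·) hu.1).trans (mul_zero t),
        (congrArg (t * ·) hu.2).trans (mul_zero t)⟩
  obtain ⟨s, t, rfl⟩ := Submodule.mem_span_pair.1 hv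
  change s * 0 + t * (Finsupp.single (0 : ℤ) (1 : k)) 0 = 0 ∧ s * 1 + t * 0 = 0 at h1
  simp only [Finsupp.single_eq_same, mul_zero, zero_add, mul_one, add_zero] at h1
  rw [h1.1, h1.2, zero_smul, zero_smul, add_zero]

end Parts

variable [CharZero k]

/-- The Lie algebra structure of the Virasoro algebra: `C` is central and
`⁅Lₘ, Lₙ⁆ = (n - m) Lₘ₊ₙ + δ_{m,-n} (m³ - m) / 12 C`. -/
noncomputable instance : LieRing (Virasoro k) where
  bracket u v := (wittBracket k u.1 v.1, cocycle k u.1 v.1)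
  add_lie u v w := Prod.ext
    (LinearMap.congr_fun (map_add (wittBracket k) u.1 v.1) w.1)
    (LinearMap.congr_fun (map_add (cocycle k) u.1 v.1) w.1)
  lie_add u v w := Prod.ext (map_add (wittBracket k u.1) v.1 w.1) (map_add (cocycle k u.1) v.1 w.1)
  lie_self u := Prod.ext
    (by
      have h := wittBracket_skew u.1 u.1
      change wittBracket k u.1 u.1 = 0
      ext i
      have hi := DFunLike.congr_fun h i
      rw [Finsupp.neg_apply] at hi
      exact self_eq_neg.1 hi)
    (self_eq_neg.1 (cocycle_skew u.1 u.1))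
  leibniz_lie u v w := Prod.ext
    (wittBracket_leibniz u.1 v.1 w.1) (cocycle_leibniz u.1 v.1 w.1)

noncomputable instance : LieAlgebra k (Virasoro k) where
  lie_smul t u v := Prod.ext
    (map_smul (wittBracket k u.1) t v.1) (map_smul (cocycle k u.1) t v.1)

variable (k)

theorem lie_L_L (m n : ℤ) :
    ⁅L k m, L k n⁆ = ((n : k) - (m : k)) • L k (m + n)
      + (if m = -n then ((m : k) ^ 3 - (m : k)) / 12 else 0) • C k := by
  have h1 : (⁅L k m, L k n⁆ : Virasoro k).1 = Finsupp.single (m + n) ((n : k) - (m : k)) := by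
    change wittBracket k (Finsupp.single m 1) (Finsupp.single n 1) = _
    rw [wittBracket_single, one_mul, one_mul]
  have h2 : (⁅L k m, L k n⁆ : Virasoro k).2
      = if m = -n then ((m : k) ^ 3 - (m : k)) / 12 else 0 := by
    change cocycle k (Finsupp.single m 1) (Finsupp.single n 1) = _
    rw [cocycle_single, one_mul, one_mul]
  refine Prod.ext ?_ ?_
  · rw [h1]
    change _ = ((n : k) - (m : k)) • Finsupp.single (m + n) (1 : k)
      + (if m = -n then ((m : k) ^ 3 - (m : k)) / 12 else 0) • (0 : ℤ →₀ k)
    rw [smul_zero, add_zero, Finsupp.smul_single, smul_eq_mul, mul_one]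
  · rw [h2]
    change _ = ((n : k) - (m : k)) * (0 : k)
      + (if m = -n then ((m : k) ^ 3 - (m : k)) / 12 else 0) * (1 : k)
    rw [mul_zero, zero_add, mul_one]

theorem lie_C (u : Virasoro k) : ⁅u, C k⁆ = 0 :=
  Prod.ext (map_zero (wittBracket k u.1)) (map_zero (cocycle k u.1))

/-- The Lie subalgebra `Vir⁺ ⊕ 𝔥` of the Virasoro algebra. -/
noncomputable def positiveBorel : LieSubalgebra k (Virasoro k) :=
  { positivePart k ⊔ cartan k with
    lie_mem' := by
      intro u v hu hv
      change u ∈ positivePart k ⊔ cartan k at hu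
      change v ∈ positivePart k ⊔ cartan k at hv
      change ⁅u, v⁆ ∈ positivePart k ⊔ cartan k
      rw [sup_eq_span] at hu hv
      induction hu using Submodule.span_induction with
      | zero => rw [zero_lie]; exact Submodule.zero_mem _
      | add u u' _ _ hu hu' => rw [add_lie]; exact Submodule.add_mem _ hu hu'
      | smul t u _ hu => rw [smul_lie]; exact Submodule.smul_mem _ t hu
      | mem u hu =>
        induction hv using Submodule.span_induction with
        | zero => rw [lie_zero]; exact Submodule.zero_mem _
        | add v v' _ _ hv hv' => rw [lie_add]; exact Submodule.add_mem _ hv hv'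
        | smul t v _ hv => rw [lie_smul]; exact Submodule.smul_mem _ t hv
        | mem v hv =>
          rcases hu with rfl | ⟨m, hm, rfl⟩
          · rw [← lie_skew, lie_C, neg_zero]; exact Submodule.zero_mem _
          · rcases hv with rfl | ⟨n, hn, rfl⟩
            · rw [lie_C]; exact Submodule.zero_mem _
            · rw [lie_L_L]
              exact Submodule.add_mem _ (Submodule.smul_mem _ _ (L_mem k (by omega)))
                (Submodule.smul_mem _ _ (C_mem k)) }

end Structure

end Virasoro

/-! Put `z = xy + yx` and `Y = y²`. Then `xz = zx`, `yz = zy + zx` and `Yz = zY + z²`, and the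
algebra is free over the ordered monomials `z ^ b Y ^ c` on `1, x, y, yx`. Ordered monomials are
encoded as `k[z][Y]`, where moving `x` or `y` across a coefficient becomes one of the differential
operators `twist` and `euler`. Spanning is a rewriting argument; uniqueness (`ofCoords_inj`) comes
from evaluating the left regular representation at `1`.

A `1`-cocycle is a derivation, hence determined by its values at `x` and `y`. In these coordinates
the two relations become differential equations over `k[z][Y]`, solvable in characteristic zero. The
relation `x² = 0` reduces the value at `x` to `x p(y²)` modulo coboundaries (`exists_d0_add_eq_x`),
which a combination of the `sₙ` removes. The cubic relation then leaves only a multiple of `c`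
(`exists_d0_add_eq_y`). So the classes of `c` and `sₙ` span.

Independence and the brackets are read off in the abelianization `k[y][ε]`. Coboundaries are
commutators and die there, while `c` and `sₙ` take the values `ε` and `y ^ (2n+1)` at `y`. Hence a
class is determined by its image at `y` (`mk_eq_of_symbol_eq`), and each bracket is a one-line
computation with polynomials. On nonnegative indices the Virasoro cocycle vanishes, so rescaling
`Lₘ` by `2 ^ (m+1)` matches the structure constants. -/

namespace SuperJordanPlane

/-! ### Differential operators on the coefficient space `k[z][Y]`. -/

section Coefficients

open Polynomial

variable (k : Type*) [Field k]

/-- The Euler operator `z ∂/∂z` on `k[z][Y]`. -/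
noncomputable def euler : k[X][X] →ₗ[k] k[X][X] :=
  Polynomial.lsum fun n => (monomial n).restrictScalars k ∘ₗ
    LinearMap.mulLeft k (X : k[X]) ∘ₗ derivative

/-- The operator `1 - z ∂/∂Y` on `k[z][Y]`. -/
noncomputable def twist : k[X][X] →ₗ[k] k[X][X] :=
  LinearMap.id - LinearMap.mulLeft k (C X : k[X][X]) ∘ₗ derivative.restrictScalars k

variable {k}

theorem twist_apply (r : k[X][X]) : twist k r = r - C X * derivative r := rfl

theorem euler_monomial (n : ℕ) (p : k[X]) :
    euler k (monomial n p) = monomial n (X * derivative p) := by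
  simp [euler, Polynomial.lsum_apply, Polynomial.sum_monomial_index]

theorem coeff_euler (r : k[X][X]) (n : ℕ) :
    (euler k r).coeff n = X * derivative (r.coeff n) := by
  induction r using Polynomial.induction_on' with
  | add p q hp hq => simp [hp, hq, mul_add]
  | monomial m p =>
    rw [euler_monomial, coeff_monomial, coeff_monomial]
    split_ifs <;> simp

theorem euler_C (p : k[X]) : euler k (C p) = C (X * derivative p) := by
  rw [← monomial_zero_left, euler_monomial, monomial_zero_left]

theorem euler_one : euler k 1 = 0 := by
  rw [← C_1, euler_C]; simp

theorem euler_C_X_mul (r : k[X][X]) : euler k (C X * r) = C X * r + C X * euler k r := by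
  ext1 n
  simp only [coeff_euler, coeff_C_mul, coeff_add, derivative_mul, derivative_X]
  ring

theorem euler_mul_X (r : k[X][X]) : euler k (r * X) = euler k r * X := by
  ext1 n
  cases n <;> simp [coeff_euler]

theorem derivative_euler (r : k[X][X]) : derivative (euler k r) = euler k (derivative r) := by
  ext1 n
  simp only [coeff_euler, coeff_derivative, derivative_mul]
  simp
  ring

theorem twist_one : twist k 1 = 1 := by simp [twist_apply]

theorem twist_C_X_mul (r : k[X][X]) : twist k (C X * r) = C X * twist k r := by
  simp only [twist_apply, derivative_mul, derivative_C]
  ring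

theorem twist_mul_X (r : k[X][X]) : twist k (r * X) = twist k r * X - C X * r := by
  simp only [twist_apply, derivative_mul, derivative_X]
  ring

/-- Linear induction for `k[z][Y]`: multiply by `z` and by `Y`, starting from `1`. -/
theorem coeff_induction {P : k[X][X] → Prop} (one : P 1)
    (add : ∀ r s, P r → P s → P (r + s)) (smul : ∀ (t : k) r, P r → P (t • r))
    (mul_z : ∀ r, P r → P (C X * r)) (mul_Y : ∀ r, P r → P (r * X)) (r : k[X][X]) : P r := by
  have hC : ∀ p : k[X], P (C p) := by
    intro p
    induction p using Polynomial.induction_on with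
    | C a =>
      have := smul a 1 one
      rwa [show a • (1 : k[X][X]) = C (C a) by
        rw [← C_1, ← C_1, smul_C, smul_C, smul_eq_mul, mul_one]] at this
    | add p q hp hq => rw [C_add]; exact add _ _ hp hq
    | monomial n a h =>
      have := mul_z _ h
      rwa [← C_mul, show X * (C a * X ^ n) = C a * X ^ (n + 1) by ring] at this
  induction r using Polynomial.induction_on with
  | C p => exact hC p
  | add p q hp hq => exact add _ _ hp hq
  | monomial n p h =>
    have := mul_Y _ h
    rwa [mul_assoc, ← pow_succ] at this

/-- The operator `z ∂/∂Y` is locally nilpotent, so `1 - z ∂/∂Y` is onto. This allows the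
coefficients of `x` and `yx` to be written as `twist k s`, the form in which right multiplication by
`y` is explicit. -/
theorem exists_twist_eq (r : k[X][X]) : ∃ s, twist k s = r := by
  have hY : ∀ n : ℕ, ∃ s, twist k s = X ^ n := by
    intro n
    induction n with
    | zero => exact ⟨1, by rw [twist_one, pow_zero]⟩
    | succ n ih =>
      obtain ⟨s, hs⟩ := ih
      -- The correction term cancels `z ∂/∂Y (Y ^ (n+1)) = (n+1) z Y ^ n`, since `twist` commutes
      -- with `z`.
      refine ⟨X ^ (n + 1) + (C X : k[X][X]) * ((n + 1 : ℕ) : k) • s, ?_⟩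
      rw [map_add, twist_C_X_mul, map_smul, hs, twist_apply, derivative_X_pow_succ]
      simp [Algebra.smul_def]
  induction r using Polynomial.induction_on with
  | C p => exact ⟨C p, by simp [twist_apply]⟩
  | add p q hp hq =>
    obtain ⟨s, rfl⟩ := hp
    obtain ⟨t, rfl⟩ := hq
    exact ⟨s + t, map_add _ _ _⟩
  | monomial n p _ =>
    obtain ⟨s, hs⟩ := hY (n + 1)
    refine ⟨C p * s, ?_⟩
    rw [← hs]
    simp only [twist_apply, derivative_mul, derivative_C]
    ring

theorem C_X_mul_cancel {r : k[X][X]} (h : C X * r = 0) : r = 0 :=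
  (mul_eq_zero.1 h).resolve_left (C_ne_zero.2 X_ne_zero)

theorem C_X_dvd_of_map_eq_zero {r : k[X][X]} (h : r.map constantCoeff = 0) :
    ∃ s, r = C X * s := by
  refine (C_dvd_iff_dvd_coeff _ _).2 fun n => X_dvd_iff.2 ?_
  simpa using congrArg (coeff · n) h

/-- Every element of `k[z][Y]` is the sum of an element of `k[Y]` and a multiple of `z`. -/
theorem exists_eq_map_C_add (r : k[X][X]) :
    ∃ (l : k[X]) (s : k[X][X]), r = l.map C + C X * s := by
  obtain ⟨s, hs⟩ := C_X_dvd_of_map_eq_zero (r := r - (r.map constantCoeff).map C) (by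
    ext n; simp)
  exact ⟨_, s, by rw [← hs]; ring⟩

variable [CharZero k]

theorem exists_derivative_eq (p : k[X]) : ∃ q : k[X], derivative q = p := by
  induction p using Polynomial.induction_on' with
  | add p q hp hq =>
    obtain ⟨s, rfl⟩ := hp
    obtain ⟨t, rfl⟩ := hq
    exact ⟨s + t, map_add _ _ _⟩
  | monomial n a =>
    refine ⟨monomial (n + 1) (a / (n + 1 : ℕ)), ?_⟩
    have : ((n + 1 : ℕ) : k) ≠ 0 := by exact_mod_cast n.succ_ne_zero
    rw [derivative_monomial, div_mul_cancel₀ _ this, Nat.add_sub_cancel]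

theorem exists_derivative_eq_outer (r : k[X][X]) : ∃ s : k[X][X], derivative s = r := by
  induction r using Polynomial.induction_on' with
  | add p q hp hq =>
    obtain ⟨s, rfl⟩ := hp
    obtain ⟨t, rfl⟩ := hq
    exact ⟨s + t, map_add _ _ _⟩
  | monomial n p =>
    refine ⟨monomial (n + 1) (C ((n + 1 : ℕ) : k)⁻¹ * p), ?_⟩
    have h0 : ((n + 1 : ℕ) : k) ≠ 0 := by exact_mod_cast n.succ_ne_zero
    rw [derivative_monomial, Nat.add_sub_cancel, mul_right_comm, ← C_eq_natCast, ← C_mul,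
      inv_mul_cancel₀ h0, C_1, one_mul]

/-- The equation satisfied by the `y`-coordinate of `D y`, for a derivation `D` with `D x = 0`,
forces this coordinate to be divisible by `z`. -/
theorem exists_eq_C_X_mul_of_euler {v w : k[X][X]}
    (h : v + 2 * X * derivative v + euler k v + C X * w = 0) : ∃ m, v = C X * m := by
  refine C_X_dvd_of_map_eq_zero ?_
  ext n
  -- At `z = 0` the last two terms vanish, and the coefficient of `Y ^ n` in `v + 2Y v'` is `(1 +
  -- 2n)` times that of `v`.
  have hn := congrArg (fun r : k[X][X] => constantCoeff (r.coeff n)) h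
  have h0 : (1 + 2 * n : k) ≠ 0 := by exact_mod_cast (by omega : 1 + 2 * n ≠ 0)
  rw [coeff_map, coeff_zero]
  refine (mul_eq_zero.1 (?_ : (1 + 2 * n : k) * _ = 0)).resolve_left h0
  cases n with
  | zero => simpa [coeff_euler, mul_assoc] using hn
  | succ n =>
    rw [mul_assoc, two_mul] at hn
    simp only [coeff_add, coeff_C_mul, coeff_X_mul, coeff_derivative, coeff_euler,
      constantCoeff_apply, mul_coeff_zero, coeff_X_zero, zero_mul, add_zero, coeff_zero] at hn
    rw [← hn]
    simp
    ring

/-- Such a `w` is a polynomial in `z` alone, and in characteristic zero `z ∂/∂z` hits everything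
without constant term. The surviving constant is what becomes the class of `c`. -/
theorem exists_C_of_derivative_eq_zero {w : k[X][X]} (h : derivative w = 0) :
    ∃ (t : k) (q : k[X]), w = C (C t) + euler k (C q) := by
  obtain ⟨g, rfl⟩ : ∃ g, w = C g := ⟨_, eq_C_of_natDegree_eq_zero (derivative_eq_zero.1 h)⟩
  obtain ⟨q, hq⟩ := exists_derivative_eq g.divX
  refine ⟨g.coeff 0, q, ?_⟩
  rw [euler_C, hq, ← C_add]
  congr 1
  rw [add_comm]
  exact (X_mul_divX_add g).symm

end Coefficients

end SuperJordanPlane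

namespace SuperJordanPlane

/-! ### Commutation rules and the normal form `r₀ + r₁ x + r₂ y + r₃ yx`. -/

section NormalForm

open Polynomial

variable {k : Type*} [Field k]

theorem x_mul_x : x k * x k = 0 := by
  have h := RingQuot.mkAlgHom_rel k (Rel.sq (k := k))
  rwa [map_pow, map_zero, sq] at h

theorem y_sq_mul_x : y k ^ 2 * x k = x k * y k ^ 2 + x k * y k * x k := by
  have h := RingQuot.mkAlgHom_rel k (Rel.cubic (k := k))
  rwa [map_mul, map_pow, map_add, map_mul, map_mul, map_mul, map_pow] at h

/-- The universal property of the super Jordan plane. -/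
noncomputable def lift {B : Type*} [Ring B] [Algebra k B] (u v : B) (h : u * u = 0)
    (h' : v ^ 2 * u = u * v ^ 2 + u * v * u) : SuperJordanPlane k →ₐ[k] B :=
  RingQuot.liftAlgHom k ⟨FreeAlgebra.lift k ![u, v], by
    rintro _ _ (_ | _)
    · simpa [sq] using h
    · simpa using h'⟩

section

variable {B : Type*} [Ring B] [Algebra k B] {u v : B} (h : u * u = 0)
  (h' : v ^ 2 * u = u * v ^ 2 + u * v * u)

@[simp]
theorem lift_x : lift u v h h' (x k) = u := by
  simp [lift, x]

@[simp]
theorem lift_y : lift u v h h' (y k) = v := by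
  simp [lift, y]

end

theorem algHom_ext {B : Type*} [Ring B] [Algebra k B] {f g : SuperJordanPlane k →ₐ[k] B}
    (hx : f (x k) = g (x k)) (hy : f (y k) = g (y k)) : f = g := by
  refine RingQuot.ringQuot_ext' _ _ _ (FreeAlgebra.hom_ext (funext fun i => ?_))
  fin_cases i
  · exact hx
  · exact hy

/-- The universal property gives a map into the subalgebra generated by `x` and `y`; composed with
the inclusion it fixes both generators, so it is the identity. -/
theorem adjoin_eq_top : Algebra.adjoin k {x k, y k} = ⊤ := by
  set S := Algebra.adjoin k {x k, y k}
  have hx : x k ∈ S := Algebra.subset_adjoin (by simp)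
  have hy : y k ∈ S := Algebra.subset_adjoin (by simp)
  let f : SuperJordanPlane k →ₐ[k] S := lift ⟨x k, hx⟩ ⟨y k, hy⟩
    (Subtype.ext x_mul_x) (Subtype.ext y_sq_mul_x)
  have hf : S.val.comp f = AlgHom.id k _ := algHom_ext (by simp [f]) (by simp [f])
  refine eq_top_iff.2 fun a _ => ?_
  have h := (f a).2
  rwa [show ((f a : S) : SuperJordanPlane k) = a from DFunLike.congr_fun hf a] at h

variable (k) in
/-- The element `z = x y + y x`. -/
def z : SuperJordanPlane k := x k * y k + y k * x k

theorem x_mul_z : x k * z k = x k * y k * x k := by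
  rw [z, mul_add, ← mul_assoc, x_mul_x, zero_mul, zero_add, mul_assoc]

theorem z_mul_x : z k * x k = x k * y k * x k := by
  rw [z, add_mul, mul_assoc (y k), x_mul_x, mul_zero, add_zero]

theorem y_mul_z : y k * z k = z k * y k + z k * x k := by
  have h := y_sq_mul_x (k := k)
  rw [z_mul_x, z]
  linear_combination (norm := noncomm_ring) h

theorem y_mul_x : y k * x k = z k - x k * y k := by rw [z]; abel

theorem x_mul_y_sq : x k * y k ^ 2 = y k ^ 2 * x k - z k * x k := by
  rw [y_sq_mul_x, z_mul_x]; abel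

theorem y_sq_mul_z : y k ^ 2 * z k = z k * y k ^ 2 + z k * z k := by
  calc y k ^ 2 * z k = y k * (y k * z k) := by rw [sq, mul_assoc]
    _ = y k * z k * y k + y k * z k * x k := by
      rw [mul_assoc, mul_assoc, ← mul_add, ← y_mul_z]
    _ = z k * y k ^ 2 + z k * (x k * y k + y k * x k) + z k * (x k * x k) := by
      rw [y_mul_z]; simp only [add_mul, mul_add, mul_assoc, sq]; abel
    _ = _ := by rw [x_mul_x, mul_zero, add_zero, ← z]

/-- The linear map `k[z][Y] → A` sending `z ^ b Y ^ c` to `z ^ b y ^ (2 c)`. -/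
noncomputable def ofCoeff : k[X][X] →ₗ[k] SuperJordanPlane k where
  toFun := eval₂ (aeval (z k) : k[X] →ₐ[k] SuperJordanPlane k).toRingHom (y k ^ 2)
  map_add' r s := eval₂_add _ _
  map_smul' t r := by
    rw [← algebraMap_smul k[X] t r, eval₂_smul]
    simp [Algebra.smul_def]

theorem ofCoeff_C (p : k[X]) : ofCoeff (C p) = aeval (z k) p := eval₂_C _ _

theorem ofCoeff_one : ofCoeff (1 : k[X][X]) = 1 := eval₂_one _ _

theorem ofCoeff_C_X_mul (r : k[X][X]) : ofCoeff (C X * r) = z k * ofCoeff r := by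
  rw [← smul_eq_C_mul]
  exact (eval₂_smul _ _ _).trans (congrArg (· * ofCoeff r) (aeval_X _))

theorem ofCoeff_neg_mul (r : k[X][X]) (a : SuperJordanPlane k) :
    ofCoeff (-r) * a = -(ofCoeff r * a) := by
  rw [map_neg]
  exact neg_mul (ofCoeff r) a

theorem ofCoeff_mul_X (r : k[X][X]) : ofCoeff (r * X) = ofCoeff r * y k ^ 2 :=
  eval₂_mul_X _ _

theorem ofCoeff_map_C (p : k[X]) : ofCoeff (p.map C) = aeval (y k ^ 2) p := by
  induction p using Polynomial.induction_on with
  | C a => rw [map_C, ofCoeff_C, aeval_C, aeval_C]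
  | add p q hp hq => rw [Polynomial.map_add, map_add, map_add, hp, hq]
  | monomial n a h =>
    rw [pow_succ, ← mul_assoc, Polynomial.map_mul, map_X, ofCoeff_mul_X, h, map_mul _ _ X, aeval_X]

/-- From `z y² = (y² - z) z`: passing `z` across `y²` shifts it by `-z`. The same shift occurs for
`x`, so one operator serves both. Since `z` and `y²` do not commute, `ofCoeff` is only linear and
the rule is proved by induction on ordered monomials. -/
theorem ofCoeff_twist_mul_z (r : k[X][X]) :
    ofCoeff (twist k r) * z k = z k * ofCoeff r := by
  induction r using coeff_induction with
  | one => rw [twist_one, ofCoeff_one, one_mul, mul_one]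
  | add r s hr hs => simp only [map_add, add_mul, mul_add, hr, hs]
  | smul t r h => simp only [map_smul, smul_mul_assoc, mul_smul_comm, h]
  | mul_z r h => rw [twist_C_X_mul, ofCoeff_C_X_mul, mul_assoc, h, ofCoeff_C_X_mul]
  | mul_Y r h =>
    rw [twist_mul_X, map_sub, ofCoeff_mul_X, ofCoeff_C_X_mul, ofCoeff_mul_X, sub_mul, mul_assoc,
      y_sq_mul_z, mul_add, ← mul_assoc, ← mul_assoc, h]
    noncomm_ring

theorem x_mul_ofCoeff (r : k[X][X]) : x k * ofCoeff r = ofCoeff (twist k r) * x k := by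
  induction r using coeff_induction with
  | one => rw [twist_one, ofCoeff_one, one_mul, mul_one]
  | add r s hr hs => simp only [map_add, add_mul, mul_add, hr, hs]
  | smul t r h => simp only [map_smul, smul_mul_assoc, mul_smul_comm, h]
  | mul_z r h =>
    rw [twist_C_X_mul, ofCoeff_C_X_mul, ofCoeff_C_X_mul, ← mul_assoc, x_mul_z, ← z_mul_x,
      mul_assoc, h, mul_assoc]
  | mul_Y r h =>
    rw [twist_mul_X, map_sub, ofCoeff_mul_X, ofCoeff_C_X_mul, ofCoeff_mul_X, ← mul_assoc, h,
      mul_assoc, x_mul_y_sq, mul_sub, ← mul_assoc _ (z k), ofCoeff_twist_mul_z]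
    simp only [mul_assoc, sub_mul]

/-- The element `y` commutes with `y²`, and `yz = zy + zx` gives `y z ^ b = z ^ b y + b z ^ b x`;
the factor `b` is `euler`, and moving the resulting `x` to the right past powers of `y²` is `twist`.
-/
theorem y_mul_ofCoeff (r : k[X][X]) :
    y k * ofCoeff r = ofCoeff r * y k + ofCoeff (twist k (euler k r)) * x k := by
  induction r using coeff_induction with
  | one => rw [euler_one, map_zero, map_zero, ofCoeff_one]; simp
  | add r s hr hs => simp only [map_add, add_mul, mul_add, hr, hs]; abel
  | smul t r h => simp only [map_smul, smul_mul_assoc, mul_smul_comm, h, smul_add]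
  | mul_z r h =>
    rw [euler_C_X_mul, map_add, twist_C_X_mul, twist_C_X_mul, map_add, ofCoeff_C_X_mul,
      ofCoeff_C_X_mul, ofCoeff_C_X_mul, ← mul_assoc, y_mul_z, add_mul, mul_assoc, h, mul_assoc,
      x_mul_ofCoeff]
    noncomm_ring
  | mul_Y r h =>
    rw [euler_mul_X, twist_mul_X, map_sub, ofCoeff_mul_X, ofCoeff_mul_X, ofCoeff_C_X_mul,
      ← mul_assoc, h, add_mul, mul_assoc _ (x k), x_mul_y_sq, ← ofCoeff_twist_mul_z]
    simp only [mul_assoc, sub_mul, mul_sub, ← pow_succ, ← pow_succ']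

/-- Left multiplication by `Y` on `k[z][Y]`, in the ordering where `z` precedes `Y`. -/
noncomputable def leftY (r : k[X][X]) : k[X][X] := r * X + C X * euler k r

theorem leftY_zero : leftY (0 : k[X][X]) = 0 := by simp [leftY]

theorem leftY_add (r s : k[X][X]) : leftY (r + s) = leftY r + leftY s := by
  simp only [leftY, map_add]
  ring

theorem leftY_neg (r : k[X][X]) : leftY (-r) = -leftY r := by
  simp only [leftY, map_neg]
  ring

theorem leftY_sub (r s : k[X][X]) : leftY (r - s) = leftY r - leftY s := by
  rw [sub_eq_add_neg, leftY_add, leftY_neg, sub_eq_add_neg]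

theorem leftY_C_X_mul (r : k[X][X]) :
    leftY (C X * r) = C X * leftY r + C X * (C X * r) := by
  simp only [leftY, euler_C_X_mul]
  ring

/-- The element `r₀ + r₁ x + r₂ y + r₃ y x`, for `rᵢ ∈ k[z][Y]`. -/
noncomputable def ofCoords (r₀ r₁ r₂ r₃ : k[X][X]) : SuperJordanPlane k :=
  ofCoeff r₀ + ofCoeff r₁ * x k + ofCoeff r₂ * y k + ofCoeff r₃ * (y k * x k)

theorem x_mul_ofCoords (r₀ r₁ r₂ r₃ : k[X][X]) : x k * ofCoords r₀ r₁ r₂ r₃ =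
    ofCoords (C X * r₂) (twist k r₀ + C X * r₃) 0 (-twist k r₂) := by
  have h1 : x k * (ofCoeff r₁ * x k) = 0 := by
    rw [← mul_assoc, x_mul_ofCoeff, mul_assoc, x_mul_x, mul_zero]
  have h2 : x k * (ofCoeff r₂ * y k)
      = z k * ofCoeff r₂ - ofCoeff (twist k r₂) * (y k * x k) := by
    rw [← mul_assoc, x_mul_ofCoeff, mul_assoc, ← ofCoeff_twist_mul_z, ← mul_sub, y_mul_x,
      sub_sub_cancel]
  have h3 : x k * (ofCoeff r₃ * (y k * x k)) = z k * ofCoeff r₃ * x k := by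
    rw [← mul_assoc, x_mul_ofCoeff, mul_assoc, ← mul_assoc (x k), ← z_mul_x, ← mul_assoc,
      ofCoeff_twist_mul_z]
  simp only [ofCoords, mul_add, map_add, ofCoeff_neg_mul, map_zero, h1, h2, h3, x_mul_ofCoeff,
    ofCoeff_C_X_mul, add_mul, zero_mul]
  abel

theorem ofCoords_mul_x (r₀ r₁ r₂ r₃ : k[X][X]) :
    ofCoords r₀ r₁ r₂ r₃ * x k = ofCoords 0 r₀ 0 r₂ := by
  simp only [ofCoords, map_zero, add_mul, mul_assoc, x_mul_x, mul_zero, zero_mul]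
  abel

theorem y_mul_ofCoords (r₀ r₁ r₂ r₃ : k[X][X]) : y k * ofCoords r₀ r₁ r₂ r₃ =
    ofCoords (leftY r₂) (twist k (euler k r₀) + leftY r₃) r₀ (r₁ - twist k (euler k r₂)) := by
  have h1 : y k * (ofCoeff r₁ * x k) = ofCoeff r₁ * (y k * x k) := by
    rw [← mul_assoc, y_mul_ofCoeff, add_mul, mul_assoc _ (x k), x_mul_x, mul_zero, add_zero,
      mul_assoc]
  have h2 : y k * (ofCoeff r₂ * y k)
      = ofCoeff (leftY r₂) - ofCoeff (twist k (euler k r₂)) * (y k * x k) := by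
    rw [leftY, map_add, ofCoeff_mul_X, ofCoeff_C_X_mul, ← ofCoeff_twist_mul_z, ← mul_assoc,
      y_mul_ofCoeff, y_mul_x]
    simp only [mul_assoc, add_mul, mul_sub, sq]
    abel
  have h3 : y k * (ofCoeff r₃ * (y k * x k)) = ofCoeff (leftY r₃) * x k := by
    rw [leftY, map_add, ofCoeff_mul_X, ofCoeff_C_X_mul, ← ofCoeff_twist_mul_z, ← mul_assoc,
      y_mul_ofCoeff, add_mul, add_mul, mul_assoc _ (x k), ← mul_assoc (x k), ← z_mul_x]
    simp only [mul_assoc, sq]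
  simp only [ofCoords, mul_add, map_add, map_sub, h1, h2, h3, y_mul_ofCoeff, add_mul, sub_mul]
  abel

/-- The product `xy = z - yx` leaves a `z` to the right of a coefficient. It can be moved left
without inverting `twist` because that coefficient is already a `twist`. -/
theorem ofCoords_twist_mul_y (r₀ s₁ r₂ s₃ : k[X][X]) :
    ofCoords r₀ (twist k s₁) r₂ (twist k s₃) * y k =
      ofCoords (C X * s₁ + r₂ * X) (C X * s₃ - twist k s₃ * X) (r₀ + C X * s₃) (-twist k s₁) := by
  have h1 : ofCoeff (twist k s₁) * x k * y k
      = z k * ofCoeff s₁ - ofCoeff (twist k s₁) * (y k * x k) := by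
    rw [← ofCoeff_twist_mul_z, ← mul_sub, y_mul_x, sub_sub_cancel, mul_assoc]
  have h3 : ofCoeff (twist k s₃) * (y k * x k) * y k
      = z k * ofCoeff s₃ * y k + z k * ofCoeff s₃ * x k
        - ofCoeff (twist k s₃) * y k ^ 2 * x k := by
    have h : y k * x k * y k = z k * y k + z k * x k - y k ^ 2 * x k := by
      rw [← y_mul_z, z, mul_add, sq, mul_assoc, mul_assoc, add_sub_cancel_right]
    rw [mul_assoc, h, ← ofCoeff_twist_mul_z]
    simp only [mul_assoc, mul_sub, mul_add]
  simp only [ofCoords, add_mul, map_add, map_sub, ofCoeff_neg_mul, h1, h3, ofCoeff_mul_X,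
    ofCoeff_C_X_mul, sub_mul]
  simp only [mul_assoc, sq]
  abel

theorem ofCoords_add (r₀ r₁ r₂ r₃ s₀ s₁ s₂ s₃ : k[X][X]) :
    ofCoords r₀ r₁ r₂ r₃ + ofCoords s₀ s₁ s₂ s₃
      = ofCoords (r₀ + s₀) (r₁ + s₁) (r₂ + s₂) (r₃ + s₃) := by
  simp only [ofCoords, map_add, add_mul]
  abel

theorem ofCoords_sub (r₀ r₁ r₂ r₃ s₀ s₁ s₂ s₃ : k[X][X]) :
    ofCoords r₀ r₁ r₂ r₃ - ofCoords s₀ s₁ s₂ s₃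
      = ofCoords (r₀ - s₀) (r₁ - s₁) (r₂ - s₂) (r₃ - s₃) := by
  simp only [ofCoords, map_sub, sub_mul]
  abel

theorem exists_ofCoords_eq (a : SuperJordanPlane k) :
    ∃ r₀ r₁ r₂ r₃, ofCoords r₀ r₁ r₂ r₃ = a := by
  -- The set of elements with coordinates contains `1` and is stable under left multiplication by
  -- the generators, hence by everything.
  suffices h : ∀ b : SuperJordanPlane k, (∃ r₀ r₁ r₂ r₃, ofCoords r₀ r₁ r₂ r₃ = b) →
      ∃ r₀ r₁ r₂ r₃, ofCoords r₀ r₁ r₂ r₃ = a * b by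
    simpa using h 1 ⟨1, 0, 0, 0, by simp [ofCoords, ofCoeff_one]⟩
  have ha : a ∈ Algebra.adjoin k {x k, y k} := adjoin_eq_top (k := k) ▸ Algebra.mem_top
  induction ha using Algebra.adjoin_induction with
  | mem a ha =>
    rintro _ ⟨r₀, r₁, r₂, r₃, rfl⟩
    rcases ha with rfl | rfl
    · exact ⟨_, _, _, _, (x_mul_ofCoords _ _ _ _).symm⟩
    · exact ⟨_, _, _, _, (y_mul_ofCoords _ _ _ _).symm⟩
  | algebraMap t =>
    rintro _ ⟨r₀, r₁, r₂, r₃, rfl⟩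
    exact ⟨t • r₀, t • r₁, t • r₂, t • r₃, by
      simp only [ofCoords, map_smul, ← Algebra.smul_def, smul_add, smul_mul_assoc]⟩
  | add a b _ _ ha hb =>
    intro c hc
    obtain ⟨r₀, r₁, r₂, r₃, hr⟩ := ha c hc
    obtain ⟨s₀, s₁, s₂, s₃, hs⟩ := hb c hc
    exact ⟨_, _, _, _, by rw [add_mul, ← hr, ← hs, ofCoords_add]⟩
  | mul a b _ _ ha hb =>
    intro c hc
    rw [mul_assoc]
    exact ha _ (hb c hc)

/-! The left regular representation in coordinates, which shows that they are unique. -/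

variable (k) in
/-- Left multiplication by `x` in coordinates. -/
noncomputable def xOp : Module.End k (Fin 4 → k[X][X]) where
  toFun r := ![C X * r 2, twist k (r 0) + C X * r 3, 0, -twist k (r 2)]
  map_add' r s := by
    ext1 i
    fin_cases i <;> simp [mul_add] <;> abel
  map_smul' t r := by
    ext1 i
    fin_cases i <;> simp

variable (k) in
/-- Left multiplication by `y` in coordinates. -/
noncomputable def yOp : Module.End k (Fin 4 → k[X][X]) where
  toFun r := ![leftY (r 2), twist k (euler k (r 0)) + leftY (r 3), r 0,
    r 1 - twist k (euler k (r 2))]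
  map_add' r s := by
    ext1 i
    fin_cases i <;> simp [leftY, mul_add, add_mul] <;> abel
  map_smul' t r := by
    ext1 i
    fin_cases i <;> simp [leftY, smul_sub]

theorem xOp_apply (r : Fin 4 → k[X][X]) :
    xOp k r = ![C X * r 2, twist k (r 0) + C X * r 3, 0, -twist k (r 2)] := rfl

theorem yOp_apply (r : Fin 4 → k[X][X]) : yOp k r = ![leftY (r 2),
    twist k (euler k (r 0)) + leftY (r 3), r 0, r 1 - twist k (euler k (r 2))] := rfl

theorem euler_twist (r : k[X][X]) :
    euler k (twist k r) = twist k (euler k r) - C X * derivative r := by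
  simp only [twist_apply, map_sub, derivative_euler, euler_C_X_mul]
  ring

theorem twist_leftY (r : k[X][X]) :
    twist k (leftY r) = leftY (twist k r) - C X * twist k r := by
  simp only [leftY, map_add, twist_mul_X, twist_C_X_mul, euler_twist]
  simp only [twist_apply]
  ring

theorem euler_leftY (r : k[X][X]) :
    euler k (leftY r) = leftY (euler k r) + C X * euler k r := by
  simp only [leftY, map_add, euler_mul_X, euler_C_X_mul]
  ring

theorem twist_euler_leftY (r : k[X][X]) :
    twist k (euler k (leftY r)) = leftY (twist k (euler k r)) := by
  rw [euler_leftY, map_add, twist_leftY, twist_C_X_mul, sub_add_cancel]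

theorem xOp_mul_xOp : xOp k * xOp k = 0 := by
  refine LinearMap.ext fun r => funext fun i => ?_
  fin_cases i <;> simp [xOp_apply, twist_C_X_mul] <;> ring

/-- The off-diagonal terms cancel because `leftY` commutes with `twist ∘ euler`. -/
theorem yOp_sq_apply (r : Fin 4 → k[X][X]) :
    (yOp k ^ 2) r = ![leftY (r 0), leftY (r 1), leftY (r 2), leftY (r 3)] := by
  rw [sq, Module.End.mul_apply]
  ext1 i
  fin_cases i <;> simp [yOp_apply, twist_euler_leftY, leftY_sub]

theorem yOp_sq_mul_xOp :
    yOp k ^ 2 * xOp k = xOp k * yOp k ^ 2 + xOp k * yOp k * xOp k := by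
  refine LinearMap.ext fun r => ?_
  rw [LinearMap.add_apply, Module.End.mul_apply, Module.End.mul_apply, Module.End.mul_apply,
    Module.End.mul_apply, yOp_sq_apply, yOp_sq_apply]
  ext1 i
  fin_cases i <;> simp [xOp_apply, yOp_apply, twist_leftY, leftY_zero, leftY_C_X_mul, leftY_add,
    leftY_neg, twist_C_X_mul] <;> ring

variable (k) in
/-- The left regular representation of the super Jordan plane in coordinates. -/
noncomputable def regular : SuperJordanPlane k →ₐ[k] Module.End k (Fin 4 → k[X][X]) :=
  lift (xOp k) (yOp k) xOp_mul_xOp yOp_sq_mul_xOp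

theorem regular_x (r : Fin 4 → k[X][X]) : regular k (x k) r = xOp k r := by simp [regular]

theorem regular_y (r : Fin 4 → k[X][X]) : regular k (y k) r = yOp k r := by simp [regular]

theorem regular_z (r : Fin 4 → k[X][X]) : regular k (z k) r = fun i => C X * r i := by
  simp only [z, map_add, map_mul, LinearMap.add_apply, Module.End.mul_apply, regular_x, regular_y]
  ext1 i
  fin_cases i <;> simp [xOp_apply, yOp_apply, euler_C_X_mul, twist_C_X_mul, leftY_zero,
    leftY_neg, twist_leftY] <;> ring

/-- In `ofCoeff (r * X)` the new `y²` acts first, so the induction has to run over all vectors `Y ^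
n v` with `v` constant. On these `euler` vanishes and `y²` just raises `n`. -/
theorem regular_ofCoeff (r : k[X][X]) (v : Fin 4 → k) :
    regular k (ofCoeff r) (fun i => C (C (v i))) = fun i => r * C (C (v i)) := by
  suffices h : ∀ n : ℕ, regular k (ofCoeff r) (fun i => X ^ n * C (C (v i)))
      = fun i => r * (X ^ n * C (C (v i))) by simpa using h 0
  induction r using coeff_induction with
  | one => intro n; simp [ofCoeff_one]
  | add r s hr hs => intro n; simp only [map_add, LinearMap.add_apply, hr, hs, add_mul]; rfl
  | smul t r h =>
    intro n
    simp only [map_smul, LinearMap.smul_apply, h, smul_mul_assoc]; rfl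
  | mul_z r h =>
    intro n
    rw [ofCoeff_C_X_mul, map_mul, Module.End.mul_apply, h, regular_z]
    simp only [mul_assoc]
  | mul_Y r h =>
    intro n
    have h1 : regular k (y k ^ 2) (fun i => X ^ n * C (C (v i)))
        = fun i => X ^ (n + 1) * C (C (v i)) := by
      have h2 (t : k) : leftY (X ^ n * C (C t)) = X ^ (n + 1) * C (C t) := by
        rw [leftY, mul_comm (X ^ n), C_mul_X_pow_eq_monomial, euler_monomial, derivative_C, mul_zero,
          map_zero, mul_zero, add_zero, ← C_mul_X_pow_eq_monomial]
        ring
      rw [map_pow, show regular k (y k) = yOp k from LinearMap.ext regular_y, yOp_sq_apply]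
      ext1 i
      fin_cases i <;> exact h2 _
    rw [ofCoeff_mul_X, map_mul, Module.End.mul_apply, h1, h]
    ext1 i
    ring

theorem regular_ofCoords (r₀ r₁ r₂ r₃ : k[X][X]) :
    regular k (ofCoords r₀ r₁ r₂ r₃) ![1, 0, 0, 0] = ![r₀, r₁, r₂, r₃] := by
  have e (v : Fin 4 → k) (w : Fin 4 → k[X][X]) (hw : w = fun i => C (C (v i))) (r : k[X][X]) :
      regular k (ofCoeff r) w = fun i => r * w i := by
    subst hw
    exact regular_ofCoeff r v
  have hx : xOp k ![1, 0, 0, 0] = ![0, 1, 0, 0] := by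
    simp [xOp_apply, twist_one]
  have hy : yOp k ![1, 0, 0, 0] = ![0, 0, 1, 0] := by
    simp [yOp_apply, euler_one, leftY]
  have hyx : yOp k ![0, 1, 0, 0] = ![0, 0, 0, 1] := by
    simp [yOp_apply, leftY]
  simp only [ofCoords, map_add, map_mul, LinearMap.add_apply, Module.End.mul_apply, regular_x,
    regular_y, hx, hy, hyx]
  rw [e ![1, 0, 0, 0] _ (by ext1 i; fin_cases i <;> simp),
    e ![0, 1, 0, 0] _ (by ext1 i; fin_cases i <;> simp),
    e ![0, 0, 1, 0] _ (by ext1 i; fin_cases i <;> simp),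
    e ![0, 0, 0, 1] _ (by ext1 i; fin_cases i <;> simp)]
  ext1 i
  fin_cases i <;> simp

theorem ofCoords_inj {r₀ r₁ r₂ r₃ s₀ s₁ s₂ s₃ : k[X][X]} :
    ofCoords r₀ r₁ r₂ r₃ = ofCoords s₀ s₁ s₂ s₃ ↔ r₀ = s₀ ∧ r₁ = s₁ ∧ r₂ = s₂ ∧ r₃ = s₃ := by
  refine ⟨fun h => ?_, by rintro ⟨rfl, rfl, rfl, rfl⟩; rfl⟩
  have h' := congrArg (fun a => regular k a ![1, 0, 0, 0]) h
  simp only [regular_ofCoords] at h'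
  exact ⟨congrFun h' 0, congrFun h' 1, congrFun h' 2, congrFun h' 3⟩

end NormalForm

end SuperJordanPlane

namespace SuperJordanPlane

/-! ### Derivations and their reduction modulo inner ones. -/

section Derivations

open Polynomial Hochschild

variable {k : Type*} [Field k]

theorem Z1_map_mul (f : Z1 k (SuperJordanPlane k)) (a b : SuperJordanPlane k) :
    f.1 (a * b) = a * f.1 b + f.1 a * b := mem_Z1.1 f.2 a b

theorem Z1_ext {f g : Z1 k (SuperJordanPlane k)} (hx : f.1 (x k) = g.1 (x k))
    (hy : f.1 (y k) = g.1 (y k)) : f = g := by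
  have map_one (f : Z1 k (SuperJordanPlane k)) : f.1 1 = 0 := by
    simpa using Z1_map_mul f 1 1
  refine Subtype.ext (LinearMap.ext fun a => ?_)
  have ha : a ∈ Algebra.adjoin k {x k, y k} := adjoin_eq_top (k := k) ▸ Algebra.mem_top
  induction ha using Algebra.adjoin_induction with
  | mem a ha =>
    rcases ha with rfl | rfl
    · exact hx
    · exact hy
  | algebraMap t => rw [Algebra.algebraMap_eq_smul_one, map_smul, map_smul, map_one, map_one]
  | add a b _ _ ha hb => rw [map_add, map_add, ha, hb]
  | mul a b _ _ ha hb => rw [Z1_map_mul, Z1_map_mul, ha, hb]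

/-- The `1`-cocycles with prescribed values on the generators. -/
theorem exists_Z1 {u v : SuperJordanPlane k} (h : x k * u + u * x k = 0)
    (h' : y k ^ 2 * u + (y k * v + v * y k) * x k = x k * (y k * v + v * y k) + u * y k ^ 2
      + (x k * y k * u + (x k * v + u * y k) * x k)) :
    ∃ f : Z1 k (SuperJordanPlane k), f.1 (x k) = u ∧ f.1 (y k) = v := by
  -- A derivation is the `ε`-part of an algebra map `A → A[ε]` lifting the identity; `h` and `h'`
  -- are the `ε`-parts of the two relations.
  let g : SuperJordanPlane k →ₐ[k] DualNumber (SuperJordanPlane k) :=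
    lift (TrivSqZeroExt.inl (x k) + TrivSqZeroExt.inr u)
      (TrivSqZeroExt.inl (y k) + TrivSqZeroExt.inr v)
      (TrivSqZeroExt.ext (by simp [x_mul_x]) (by simpa using h))
      (TrivSqZeroExt.ext (by simpa [sq] using y_sq_mul_x) (by
        simpa [sq, add_mul, add_assoc] using h'))
  have hg : (TrivSqZeroExt.fstHom k _ _).comp g = AlgHom.id k _ :=
    algHom_ext (by simp [g]) (by simp [g])
  have hg' (a : SuperJordanPlane k) : (g a).fst = a := DFunLike.congr_fun hg a
  refine ⟨⟨(TrivSqZeroExt.sndHom _ _).restrictScalars k ∘ₗ g.toLinearMap, mem_Z1.2 fun a b => ?_⟩,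
    ?_, ?_⟩
  · simp [hg']
  · simp [g]
  · simp [g]

theorem y_pow_two_mul (n : ℕ) : y k ^ (2 * n) = ofCoeff (X ^ n) := by
  rw [← map_X (C : k →+* k[X]), ← Polynomial.map_pow, ofCoeff_map_C, map_pow, aeval_X, pow_mul]

theorem exists_c : ∃ f : Z1 k (SuperJordanPlane k), f.1 (x k) = 0 ∧ f.1 (y k) = x k := by
  refine exists_Z1 (by simp) ?_
  simp only [mul_zero, zero_add, zero_mul, add_zero, x_mul_x, add_mul, mul_add, mul_assoc]
  simp only [← mul_assoc, x_mul_x, zero_mul, add_zero]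

/-- The factor `2n + 1` balances the cubic relation: with `w = y ^ (2n)`, moving `x` across `y ^
(2n+2)` produces `2(n+1) z w x` on the left, against `(1 + (2n+1)) x w y x = (2n+2) z w x` on the
right. -/
theorem exists_s (n : ℕ) : ∃ f : Z1 k (SuperJordanPlane k),
    f.1 (x k) = (2 * (n : k) + 1) • (x k * y k ^ (2 * n)) ∧ f.1 (y k) = y k ^ (2 * n + 1) := by
  set w := y k ^ (2 * n) with hw
  have hwY : w * y k ^ 2 = y k ^ 2 * w := by rw [hw, ← pow_add, ← pow_add, add_comm]
  have hv : y k ^ (2 * n + 1) = w * y k := pow_succ _ _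
  have hv' : y k * (w * y k) = w * y k ^ 2 := by
    rw [← mul_assoc, hw, ← pow_succ', pow_succ, mul_assoc, ← sq]
  have h0 : x k * w * x k = 0 := by
    rw [hw, y_pow_two_mul, x_mul_ofCoeff, mul_assoc, x_mul_x, mul_zero]
  have h1 : x k * w * y k * x k = z k * w * x k := by
    rw [hw, y_pow_two_mul, x_mul_ofCoeff, mul_assoc, mul_assoc, ← mul_assoc (x k), ← z_mul_x,
      ← mul_assoc, ofCoeff_twist_mul_z]
  have h2 : w * y k ^ 2 * x k = x k * w * y k ^ 2 + ((n : k) + 1) • (z k * w * x k) := by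
    have h3 : twist k (X ^ (n + 1)) + ((n : k) + 1) • (C X * X ^ n) = X ^ (n + 1) := by
      rw [twist_apply, derivative_X_pow_succ]
      simp [Algebra.smul_def]
      ring
    rw [hw, mul_assoc (x k), y_pow_two_mul, ← ofCoeff_mul_X, ← pow_succ, x_mul_ofCoeff,
      ← ofCoeff_C_X_mul, ← smul_mul_assoc, ← map_smul, ← add_mul, ← map_add, h3]
  have h4 : y k ^ 2 * (x k * w) = x k * w * y k ^ 2 + x k * y k * x k * w := by
    rw [← mul_assoc, y_sq_mul_x, mul_assoc (x k) w, hwY]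
    noncomm_ring
  refine exists_Z1 ?_ ?_
  · rw [mul_smul_comm, ← mul_assoc, x_mul_x, zero_mul, smul_mul_assoc, h0, smul_zero, add_zero]
  · rw [hv, hv', mul_assoc w (y k) (y k), ← sq, add_mul, add_mul, mul_add, h2, mul_smul_comm, h4,
      smul_mul_assoc, smul_mul_assoc, smul_mul_assoc, h1, mul_smul_comm, ← mul_assoc (x k) w (y k),
      h1, ← mul_assoc (x k) w, ← mul_assoc (x k * y k)]
    module

theorem ofCoords_zero : ofCoords (0 : k[X][X]) 0 0 0 = 0 := by simp [ofCoords]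

theorem d0_ofCoords_x (a₀ a₁ a₂ a₃ : k[X][X]) :
    d0 k (SuperJordanPlane k) (ofCoords a₀ a₁ a₂ a₃) (x k) =
      ofCoords (C X * a₂) (C X * (a₃ - derivative a₀)) 0 (-twist k a₂ - a₂) := by
  rw [d0_apply, x_mul_ofCoords, ofCoords_mul_x, ofCoords_sub]
  congr 1
  · ring
  · rw [twist_apply]; ring
  · ring

theorem d0_ofCoords_y (a₀ b₁ b₃ : k[X][X]) :
    d0 k (SuperJordanPlane k) (ofCoords a₀ (twist k b₁) 0 (twist k b₃)) (y k) =
      ofCoords (-(C X * b₁)) (twist k (euler k a₀) + leftY (twist k b₃) + twist k b₃ * X - C X * b₃)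
        (-(C X * b₃)) (2 * twist k b₁) := by
  rw [d0_apply, y_mul_ofCoords, ofCoords_twist_mul_y, ofCoords_sub, map_zero, map_zero, leftY_zero]
  congr 1 <;> ring

/-- The conditions on the coordinates of `f y`, for a `1`-cocycle `f` with `f x = 0`. -/
theorem Z1_coords {f : Z1 k (SuperJordanPlane k)} (hf : f.1 (x k) = 0) {v₀ w₁ v₂ w₃ : k[X][X]}
    (hv : f.1 (y k) = ofCoords v₀ (twist k w₁) v₂ (twist k w₃)) :
    2 * v₀ + C X * w₃ = 0 ∧
      v₂ + 2 * X * derivative v₂ + euler k v₂ + C X * derivative w₁ = 0 := by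
  have h := congrArg f.1 (y_sq_mul_x (k := k))
  rw [map_add, Z1_map_mul, Z1_map_mul f (x k), Z1_map_mul f (x k * y k), Z1_map_mul f (x k), sq,
    Z1_map_mul f (y k), hf] at h
  simp only [mul_zero, zero_mul, add_zero, zero_add] at h
  rw [hv, y_mul_ofCoords, ofCoords_twist_mul_y, ofCoords_add, x_mul_ofCoords, x_mul_ofCoords,
    ofCoords_mul_x, ofCoords_mul_x, ofCoords_add, ofCoords_inj] at h
  obtain ⟨h0, h1, -, -⟩ := h
  -- Only the coordinates at `1` and `x` are needed; both are the claimed equations multiplied by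
  -- `z`.
  refine ⟨C_X_mul_cancel (by linear_combination -h0), C_X_mul_cancel ?_⟩
  simp only [leftY, twist_apply, derivative_add, derivative_mul, derivative_C, derivative_X,
    derivative_euler] at h1
  linear_combination h1

variable [CharZero k]

theorem C_C_inv_two_mul_two : C (C (2⁻¹ : k)) * 2 = (1 : k[X][X]) := by
  rw [← map_ofNat (C.comp C : k →+* k[X][X]) 2, RingHom.comp_apply, ← C_mul, ← C_mul,
    inv_mul_cancel₀ two_ne_zero, C_1, C_1]

/-- Modulo coboundaries, the value of a `1`-cocycle at `x` is `x p(y²)` for a polynomial `p`. -/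
theorem exists_d0_add_eq_x (f : Z1 k (SuperJordanPlane k)) : ∃ (a : SuperJordanPlane k) (p : k[X]),
    f.1 (x k) = d0 k _ a (x k) + x k * aeval (y k ^ 2) p := by
  obtain ⟨u₀, u₁, u₂, u₃, hu⟩ := exists_ofCoords_eq (f.1 (x k))
  have h := Z1_map_mul f (x k) (x k)
  rw [x_mul_x, map_zero, ← hu, x_mul_ofCoords, ofCoords_mul_x, ofCoords_add, ← ofCoords_zero,
    ofCoords_inj] at h
  obtain ⟨h0, h1, -, -⟩ := h
  obtain rfl : u₂ = 0 := C_X_mul_cancel (by linear_combination -h0)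
  obtain ⟨w, rfl⟩ : ∃ w, u₀ = C X * w := by
    -- The coordinate at `x` of `x f(x) + f(x) x = 0` reads `2 u₀ = z (∂u₀/∂Y - u₃)`.
    refine ⟨C (C (2⁻¹ : k)) * (derivative u₀ - u₃), ?_⟩
    rw [twist_apply] at h1
    linear_combination (-C (C (2⁻¹ : k))) * h1 - u₀ * C_C_inv_two_mul_two (k := k)
  obtain ⟨p, m, rfl⟩ := exists_eq_map_C_add u₁
  have h3 : u₃ = -twist k w - w := by
    rw [← sub_eq_zero]
    refine C_X_mul_cancel ?_
    rw [twist_C_X_mul] at h1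
    linear_combination -h1
  -- The entry `w` produces `u₀` and `u₃`. In the last entry, `m` gives the part of `u₁` divisible
  -- by `z`, and the derivative makes up for `x p(y²)` having coefficient `p - z p'` at `x`.
  refine ⟨ofCoords 0 0 w (m + derivative (p.map C)), p, ?_⟩
  rw [← hu, d0_ofCoords_x, ← ofCoeff_map_C, x_mul_ofCoeff,
    show ofCoeff (twist k (p.map C)) * x k = ofCoords 0 (twist k (p.map C)) 0 0 by
      simp [ofCoords], ofCoords_add, h3]
  congr 1
  · ring
  · rw [twist_apply, derivative_zero]; ring
  · ring
  · ring

/-- A `1`-cocycle vanishing at `x` is cohomologous to a multiple of the one that sends `y`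
to `x`. -/
theorem exists_d0_add_eq_y {f : Z1 k (SuperJordanPlane k)} (hf : f.1 (x k) = 0) :
    ∃ (a : SuperJordanPlane k) (t : k),
      d0 k _ a (x k) = 0 ∧ f.1 (y k) = d0 k _ a (y k) + t • x k := by
  obtain ⟨v₀, v₁, v₂, v₃, hv⟩ := exists_ofCoords_eq (f.1 (y k))
  obtain ⟨w₁, rfl⟩ := exists_twist_eq v₁
  obtain ⟨w₃, rfl⟩ := exists_twist_eq v₃
  obtain ⟨h0, h2⟩ := Z1_coords hf hv.symm
  obtain ⟨m, rfl⟩ := exists_eq_C_X_mul_of_euler h2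
  obtain ⟨b, rfl⟩ : ∃ b, w₃ = 2 * b := ⟨C (C (2⁻¹ : k)) * w₃, by
    rw [← mul_assoc, mul_comm 2, C_C_inv_two_mul_two, one_mul]⟩
  -- For `a` without `y`-coordinate, `d⁰ a` vanishes at `x` exactly when `a₃ = ∂a₀/∂Y`; this choice
  -- of `s` secures it. The entries `b` and `-m` are chosen to cancel the coordinates of `f y` at
  -- `1`, `y` and `yx`.
  obtain ⟨s, hs⟩ := exists_derivative_eq_outer (twist k (-m))
  set a := ofCoords s (twist k b) 0 (twist k (-m)) with ha
  have hax : d0 k _ a (x k) = 0 := by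
    rw [ha, d0_ofCoords_x, hs, map_zero, ← ofCoords_zero]
    congr 1 <;> ring
  obtain ⟨w, hw⟩ : ∃ w, f.1 (y k) = d0 k _ a (y k) + ofCoords 0 (twist k w) 0 (twist k 0) := by
    obtain ⟨w, hw⟩ := exists_twist_eq (twist k w₁ -
      (twist k (euler k s) + leftY (twist k (-m)) + twist k (-m) * X - C X * -m))
    refine ⟨w, ?_⟩
    rw [hw, ← hv, ha, d0_ofCoords_y, ofCoords_add, ofCoords_inj]
    refine ⟨?_, by ring, by ring, ?_⟩
    · have h2 : (2 : k[X][X]) ≠ 0 := two_ne_zero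
      exact mul_left_cancel₀ h2 (by linear_combination h0)
    · rw [map_zero, two_mul, map_add]; ring
  -- The cubic relation applied to the remainder, whose value at `y` is a coefficient times `x`,
  -- leaves `z ∂w/∂Y = 0`.
  obtain ⟨-, h⟩ := Z1_coords (f := f - ⟨d0 k _ a, d0_mem_Z1 k _ a⟩) (v₀ := 0) (w₁ := w) (v₂ := 0)
    (w₃ := 0) (by
      change f.1 (x k) - d0 k _ a (x k) = 0
      rw [hf, hax, sub_zero]) (by
      change f.1 (y k) - d0 k _ a (y k) = _
      rw [hw, add_sub_cancel_left])
  obtain ⟨t, q, rfl⟩ := exists_C_of_derivative_eq_zero (w := w) (C_X_mul_cancel (by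
    simpa using h))
  -- Adding a polynomial `q` in `z` keeps the value at `x` zero and absorbs the nonconstant part
  -- `euler q` of `w`.
  refine ⟨a + ofCoords (C q) (twist k 0) 0 (twist k 0), t, ?_, ?_⟩
  · rw [map_add, LinearMap.add_apply, hax, d0_ofCoords_x, ← ofCoords_zero]
    simp [ofCoords]
  · rw [map_add, LinearMap.add_apply, hw, d0_ofCoords_y (C q) 0 0, add_assoc]
    have ht : t • x k = ofCoords 0 (twist k (C (C t))) 0 0 := by
      simp [ofCoords, ofCoeff_C, twist_apply, Algebra.smul_def]
    rw [ht, ofCoords_add, map_zero, leftY_zero, map_add, add_right_inj, ofCoords_inj]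
    refine ⟨?_, ?_, ?_, ?_⟩ <;> ring

end Derivations

end SuperJordanPlane

/-! ### Coordinates on `Vir⁺ ⊕ 𝔥` in the rescaled basis. -/

namespace Virasoro

variable (k : Type*) [Field k]

/-- The linear map sending `(t, β)` to `t C + ∑ₙ βₙ 2ⁿ⁺¹ Lₙ`. -/
noncomputable def ofFinsupp : k × (ℕ →₀ k) →ₗ[k] Virasoro k :=
  (LinearMap.toSpanSingleton k _ (C k)).coprod
    (Finsupp.linearCombination k fun n : ℕ => (2 : k) ^ (n + 1) • L k n)

variable {k}

theorem ofFinsupp_apply (t : k) (β : ℕ →₀ k) : ofFinsupp k (t, β) =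
    t • C k + Finsupp.linearCombination k (fun n : ℕ => (2 : k) ^ (n + 1) • L k n) β := rfl

theorem ofFinsupp_mem (p : k × (ℕ →₀ k)) : ofFinsupp k p ∈ positivePart k ⊔ cartan k := by
  obtain ⟨t, β⟩ := p
  rw [ofFinsupp_apply]
  refine Submodule.add_mem _ (Submodule.smul_mem _ _ (C_mem k)) ?_
  rw [Finsupp.linearCombination_apply]
  exact Submodule.sum_mem _ fun n _ =>
    Submodule.smul_mem _ _ (Submodule.smul_mem _ _ (L_mem k n.cast_nonneg))

variable (k) in
/-- The projection of the Virasoro algebra onto the Witt algebra. -/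
noncomputable def fstHom : Virasoro k →ₗ[k] ℤ →₀ k := LinearMap.fst k (ℤ →₀ k) k

variable (k) in
/-- The coordinate at `C`. -/
noncomputable def sndHom : Virasoro k →ₗ[k] k := LinearMap.snd k (ℤ →₀ k) k

theorem fstHom_ofFinsupp (t : k) (β : ℕ →₀ k) (n : ℕ) :
    fstHom k (ofFinsupp k (t, β)) n = 2 ^ (n + 1) * β n := by
  have hC : fstHom k (C k) = 0 := rfl
  have hL (n : ℤ) : fstHom k (L k n) = Finsupp.single n 1 := rfl
  rw [ofFinsupp_apply, map_add, map_smul, hC, smul_zero, zero_add]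
  induction β using Finsupp.induction_linear with
  | zero => simp
  | add f g hf hg => simp only [map_add, Finsupp.add_apply, hf, hg, mul_add]
  | single m a =>
    rw [Finsupp.linearCombination_single, map_smul, map_smul, hL]
    by_cases h : m = n
    · subst h
      simp [mul_comm]
    · simp [h]

theorem sndHom_ofFinsupp (t : k) (β : ℕ →₀ k) : sndHom k (ofFinsupp k (t, β)) = t := by
  have hC : sndHom k (C k) = 1 := rfl
  have hL (n : ℤ) : sndHom k (L k n) = 0 := rfl
  rw [ofFinsupp_apply, map_add, map_smul, hC, Finsupp.linearCombination_apply, Finsupp.sum, map_sum]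
  simp [hL]

variable [CharZero k]

theorem ofFinsupp_injective : Function.Injective (ofFinsupp k) := by
  rintro ⟨t, β⟩ ⟨t', β'⟩ h
  have h1 := congrArg (sndHom k) h
  rw [sndHom_ofFinsupp, sndHom_ofFinsupp] at h1
  refine Prod.ext h1 (Finsupp.ext fun n => ?_)
  have h2 := DFunLike.congr_fun (congrArg (fstHom k) h) (n : ℤ)
  rw [fstHom_ofFinsupp, fstHom_ofFinsupp] at h2
  exact mul_left_cancel₀ (pow_ne_zero _ two_ne_zero) h2

theorem exists_ofFinsupp_eq {u : Virasoro k} (hu : u ∈ positivePart k ⊔ cartan k) :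
    ∃ p, ofFinsupp k p = u := by
  suffices h : positivePart k ⊔ cartan k ≤ LinearMap.range (ofFinsupp k) from h hu
  rw [sup_eq_span, Submodule.span_le]
  rintro u (rfl | ⟨n, hn, rfl⟩)
  · exact ⟨(1, 0), by simp [ofFinsupp_apply]⟩
  · lift n to ℕ using hn
    refine ⟨(0, Finsupp.single n ((2 : k) ^ (n + 1))⁻¹), ?_⟩
    rw [ofFinsupp_apply, zero_smul, zero_add, Finsupp.linearCombination_single, smul_smul,
      inv_mul_cancel₀ (pow_ne_zero _ two_ne_zero), one_smul]

variable (k) in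
/-- Coordinates on `Vir⁺ ⊕ 𝔥` for the basis `C`, `2ⁿ⁺¹ Lₙ`. -/
noncomputable def positiveBorelEquiv : (k × (ℕ →₀ k)) ≃ₗ[k] positiveBorel k :=
  LinearEquiv.ofBijective ((ofFinsupp k).codRestrict (positiveBorel k).toSubmodule ofFinsupp_mem)
    ⟨fun _ _ h => ofFinsupp_injective (congrArg Subtype.val h), fun u => by
      obtain ⟨p, hp⟩ := exists_ofFinsupp_eq u.2
      exact ⟨p, Subtype.ext hp⟩⟩

theorem coe_positiveBorelEquiv (p : k × (ℕ →₀ k)) :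
    (positiveBorelEquiv k p : Virasoro k) = ofFinsupp k p := rfl

/-- For nonnegative indices `m = -n` forces `m = 0`, where `m³ - m` vanishes, so no central term
appears. The factor `2` is the surplus in `2 ^ (m+1) 2 ^ (n+1) = 2 · 2 ^ (n+m+1)`. -/
theorem lie_two_pow_smul_L (m n : ℕ) :
    ⁅(2 : k) ^ (m + 1) • L k m, (2 : k) ^ (n + 1) • L k n⁆
      = (2 * ((n : k) - (m : k))) • (2 : k) ^ (n + m + 1) • L k (n + m : ℕ) := by
  have h : (if (m : ℤ) = -n then (((m : ℤ) : k) ^ 3 - ((m : ℤ) : k)) / 12 else 0) = 0 := by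
    split_ifs with h
    · obtain rfl : m = 0 := by omega
      simp
    · rfl
  rw [smul_lie, lie_smul, lie_L_L, h, zero_smul, add_zero, smul_smul, smul_smul, smul_smul,
    Nat.cast_add, add_comm (m : ℤ)]
  congr 1
  push_cast
  ring

end Virasoro

namespace SuperJordanPlane

/-! ### Symbols, the basis of `HH¹`, and the Lie isomorphism. -/

section Cohomology

open Polynomial Hochschild

variable (k : Type*) [Field k]

/-- The `1`-cocycle with `c x = 0` and `c y = x`. -/
noncomputable def c : Z1 k (SuperJordanPlane k) := (exists_c (k := k)).choose

/-- The `1`-cocycle with `sₙ x = (2 n + 1) x y²ⁿ` and `sₙ y = y²ⁿ⁺¹`. -/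
noncomputable def s (n : ℕ) : Z1 k (SuperJordanPlane k) := (exists_s (k := k) n).choose

theorem c_x : (c k).1 (x k) = 0 := (exists_c (k := k)).choose_spec.1

theorem c_y : (c k).1 (y k) = x k := (exists_c (k := k)).choose_spec.2

theorem s_x (n : ℕ) : (s k n).1 (x k) = (2 * (n : k) + 1) • (x k * y k ^ (2 * n)) :=
  (exists_s (k := k) n).choose_spec.1

theorem s_y (n : ℕ) : (s k n).1 (y k) = y k ^ (2 * n + 1) :=
  (exists_s (k := k) n).choose_spec.2

/-- The abelianization `A → k[y][ε]` of the super Jordan plane, with `x ↦ ε`. -/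
noncomputable def abelianization : SuperJordanPlane k →ₐ[k] DualNumber k[X] :=
  lift DualNumber.eps (TrivSqZeroExt.inl X) DualNumber.eps_mul_eps (by
    rw [mul_comm, mul_right_comm, DualNumber.eps_mul_eps, zero_mul, add_zero])

/-- The value at `y` of a `1`-cocycle, in the abelianization. -/
noncomputable def symbol : Z1 k (SuperJordanPlane k) →ₗ[k] DualNumber k[X] where
  toFun f := abelianization k (f.1 (y k))
  map_add' f g := map_add (abelianization k) (f.1 (y k)) (g.1 (y k))
  map_smul' t f := map_smul (abelianization k) t (f.1 (y k))

variable {k}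

theorem symbol_apply (f : Z1 k (SuperJordanPlane k)) :
    symbol k f = abelianization k (f.1 (y k)) := rfl

theorem abelianization_x : abelianization k (x k) = DualNumber.eps := lift_x _ _

theorem abelianization_y : abelianization k (y k) = TrivSqZeroExt.inl X := lift_y _ _

/-- The value of an inner derivation is a commutator, and the target is commutative. -/
theorem symbol_d0 {f : Z1 k (SuperJordanPlane k)} {a : SuperJordanPlane k}
    (h : d0 k _ a = (f : Module.End k (SuperJordanPlane k))) : symbol k f = 0 := by
  rw [symbol_apply, ← h, d0_apply, map_sub, map_mul, map_mul, mul_comm, sub_self]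

theorem symbol_eq_of_mk_eq {f g : Z1 k (SuperJordanPlane k)} (h : HH1.mk f = HH1.mk g) :
    symbol k f = symbol k g := by
  have h' : HH1.mk (f - g) = 0 := by
    rw [← sub_eq_zero] at h
    exact h
  obtain ⟨a, ha⟩ := HH1.mk_eq_zero.1 h'
  rw [← sub_eq_zero, ← map_sub, symbol_d0 ha]

theorem symbol_c : symbol k (c k) = DualNumber.eps := by
  rw [symbol_apply, c_y, abelianization_x]

theorem symbol_s (n : ℕ) : symbol k (s k n) = TrivSqZeroExt.inl (X ^ (2 * n + 1)) := by
  rw [symbol_apply, s_y, map_pow, abelianization_y, TrivSqZeroExt.inl_pow]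

theorem abelianization_map_y_pow (f : Z1 k (SuperJordanPlane k)) (n : ℕ) :
    abelianization k (f.1 (y k ^ (n + 1))) =
      ((n : k) + 1) • (TrivSqZeroExt.inl X ^ n * symbol k f) := by
  induction n with
  | zero => simp [symbol_apply]
  | succ n ih =>
    rw [pow_succ, Z1_map_mul, map_add, map_mul, map_mul, ih, map_pow, abelianization_y,
      ← symbol_apply, smul_mul_assoc, mul_right_comm, ← pow_succ]
    push_cast
    module

variable (k) in
/-- The cocycles `t c + ∑ₙ βₙ sₙ`. -/
noncomputable def ofFinsupp : k × (ℕ →₀ k) →ₗ[k] Z1 k (SuperJordanPlane k) :=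
  (LinearMap.toSpanSingleton k _ (c k)).coprod (Finsupp.linearCombination k (s k))

theorem ofFinsupp_apply (t : k) (β : ℕ →₀ k) :
    ofFinsupp k (t, β) = t • c k + Finsupp.linearCombination k (s k) β := rfl

theorem symbol_ofFinsupp (t : k) (β : ℕ →₀ k) : symbol k (ofFinsupp k (t, β)) =
    TrivSqZeroExt.inl (β.sum fun n a => monomial (2 * n + 1) a) + t • DualNumber.eps := by
  rw [ofFinsupp_apply, map_add, map_smul, symbol_c, add_comm]
  congr 1
  induction β using Finsupp.induction_linear with
  | zero => simp
  | add f g hf hg =>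
    rw [map_add, map_add, hf, hg, Finsupp.sum_add_index' (by simp) (by simp),
      TrivSqZeroExt.inl_add]
  | single m a =>
    rw [Finsupp.linearCombination_single, map_smul, symbol_s, Finsupp.sum_single_index (by simp),
      ← TrivSqZeroExt.inl_smul, smul_X_eq_monomial]

/-- The symbols `ε` and `y ^ (2n+1)` are linearly independent. As symbols kill coboundaries, this
gives independence in cohomology too. -/
theorem symbol_ofFinsupp_eq_zero {p : k × (ℕ →₀ k)} (h : symbol k (ofFinsupp k p) = 0) :
    p = 0 := by
  obtain ⟨t, β⟩ := p
  rw [symbol_ofFinsupp] at h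
  have h1 := congrArg TrivSqZeroExt.fst h
  have h2 := congrArg TrivSqZeroExt.snd h
  refine Prod.ext ?_ (Finsupp.ext fun n => ?_)
  · rw [TrivSqZeroExt.snd_add, TrivSqZeroExt.snd_inl, zero_add, TrivSqZeroExt.snd_smul,
      DualNumber.snd_eps, TrivSqZeroExt.snd_zero, ← C_1, smul_C, smul_eq_mul, mul_one] at h2
    exact C_eq_zero.1 h2
  · have h3 := congrArg (coeff · (2 * n + 1)) h1
    simpa [Finsupp.sum, coeff_monomial] using h3

variable [CharZero k]

theorem exists_mk_ofFinsupp_eq (f : Z1 k (SuperJordanPlane k)) :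
    ∃ p, HH1.mk (ofFinsupp k p) = HH1.mk f := by
  obtain ⟨a, p, hp⟩ := exists_d0_add_eq_x f
  obtain ⟨β, hβ⟩ : ∃ β, (ofFinsupp k (0, β)).1 (x k) = x k * aeval (y k ^ 2) p := by
    clear hp
    induction p using Polynomial.induction_on' with
    | add p q hp hq =>
      obtain ⟨β, hβ⟩ := hp
      obtain ⟨γ, hγ⟩ := hq
      refine ⟨β + γ, ?_⟩
      rw [map_add, mul_add, ← hβ, ← hγ, ← zero_add (0 : k), ← Prod.mk_add_mk, map_add, zero_add]
      rfl
    | monomial n r =>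
      -- Characteristic zero lets `sₙ` be normalized so that its value at `x` is `x y ^ (2n)`.
      have hn : 2 * (n : k) + 1 ≠ 0 := by exact_mod_cast (2 * n).succ_ne_zero
      refine ⟨Finsupp.single n (r / (2 * n + 1)), ?_⟩
      rw [ofFinsupp_apply, zero_smul, zero_add, Finsupp.linearCombination_single]
      change (r / (2 * (n : k) + 1)) • (s k n).1 (x k) = _
      rw [s_x, smul_smul, div_mul_cancel₀ _ hn, aeval_monomial, ← Algebra.smul_def,
        mul_smul_comm, pow_mul]
  obtain ⟨b, t, hb, hb'⟩ := exists_d0_add_eq_y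
    (f := f - ⟨d0 k _ a, d0_mem_Z1 k _ a⟩ - ofFinsupp k (0, β)) (by
      change f.1 (x k) - d0 k _ a (x k) - (ofFinsupp k (0, β)).1 (x k) = 0
      rw [hp, hβ, add_sub_cancel_left, sub_self])
  refine ⟨(t, β), ?_⟩
  rw [eq_comm, ← sub_eq_zero]
  change HH1.mk (f - ofFinsupp k (t, β)) = 0
  refine HH1.mk_eq_zero.2 ⟨a + b, ?_⟩
  refine congrArg Subtype.val (Z1_ext (f := ⟨_, d0_mem_Z1 k _ (a + b)⟩)
    (g := f - ofFinsupp k (t, β)) ?_ ?_)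
  · rw [ofFinsupp_apply, zero_smul, zero_add] at hβ
    change d0 k _ (a + b) (x k) = f.1 (x k) -
      (t • (c k).1 (x k) + (Finsupp.linearCombination k (s k) β).1 (x k))
    rw [map_add, LinearMap.add_apply, hb, hp, hβ, c_x, smul_zero, zero_add, add_zero,
      add_sub_cancel_right]
  · rw [ofFinsupp_apply, zero_smul, zero_add] at hb'
    change f.1 (y k) - d0 k _ a (y k) - (Finsupp.linearCombination k (s k) β).1 (y k) = _ at hb'
    change d0 k _ (a + b) (y k) = f.1 (y k) -
      (t • (c k).1 (y k) + (Finsupp.linearCombination k (s k) β).1 (y k))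
    rw [map_add, LinearMap.add_apply, c_y, eq_sub_of_add_eq hb'.symm]
    abel

/-- A class in `HH¹` is determined by the symbols of its representatives. -/
theorem mk_eq_of_symbol_eq {f g : Z1 k (SuperJordanPlane k)} (h : symbol k f = symbol k g) :
    HH1.mk f = HH1.mk g := by
  obtain ⟨p, hp⟩ := exists_mk_ofFinsupp_eq (f - g)
  have h0 : symbol k (ofFinsupp k p) = 0 := by
    rw [symbol_eq_of_mk_eq hp, map_sub, h, sub_self]
  rw [symbol_ofFinsupp_eq_zero h0, map_zero] at hp
  rw [← sub_eq_zero]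
  exact hp.symm

variable (k) in
/-- Coordinates on `HH¹` for the basis given by the classes of `c` and `sₙ`. -/
noncomputable def HH1Equiv : (k × (ℕ →₀ k)) ≃ₗ[k] HH1 k (SuperJordanPlane k) :=
  LinearEquiv.ofBijective ((B1 k (SuperJordanPlane k)).toSubmodule.mkQ ∘ₗ ofFinsupp k) <| by
    constructor
    · refine (injective_iff_map_eq_zero _).2 fun p hp => symbol_ofFinsupp_eq_zero ?_
      obtain ⟨a, ha⟩ := HH1.mk_eq_zero.1 hp
      exact symbol_d0 ha
    · intro f
      obtain ⟨f, rfl⟩ := Submodule.Quotient.mk_surjective _ f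
      exact exists_mk_ofFinsupp_eq f

theorem HH1Equiv_apply (p : k × (ℕ →₀ k)) : HH1Equiv k p = HH1.mk (ofFinsupp k p) := rfl

theorem HH1Equiv_c : HH1Equiv k (1, 0) = HH1.mk (c k) := by
  rw [HH1Equiv_apply, ofFinsupp_apply, map_zero, one_smul, add_zero]

theorem HH1Equiv_s (n : ℕ) : HH1Equiv k (0, Finsupp.single n 1) = HH1.mk (s k n) := by
  rw [HH1Equiv_apply, ofFinsupp_apply, Finsupp.linearCombination_single, one_smul, zero_smul,
    zero_add]

theorem HH1_induction {P : HH1 k (SuperJordanPlane k) → Prop} (hc : P (HH1.mk (c k)))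
    (hs : ∀ n, P (HH1.mk (s k n))) (add : ∀ u v, P u → P v → P (u + v))
    (smul : ∀ (t : k) u, P u → P (t • u)) (u : HH1 k (SuperJordanPlane k)) : P u := by
  obtain ⟨⟨t, β⟩, rfl⟩ := (HH1Equiv k).surjective u
  rw [show (t, β) = t • ((1 : k), (0 : ℕ →₀ k)) + (0, β) by simp, map_add, map_smul, HH1Equiv_c]
  refine add _ _ (smul _ _ hc) ?_
  induction β using Finsupp.induction_linear with
  | zero =>
    have := smul 0 _ hc
    rwa [zero_smul, ← map_zero (HH1Equiv k)] at this
  | add f g hf hg =>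
    rw [← zero_add (0 : k), ← Prod.mk_add_mk, map_add]
    exact add _ _ hf hg
  | single n a =>
    rw [show ((0 : k), Finsupp.single n a) = a • (0, Finsupp.single n 1) by simp, map_smul,
      HH1Equiv_s]
    exact smul _ _ (hs n)

/-- On `sₙ`, both `c(y ^ (2n+1))` and `sₙ(x)` become `(2n+1) y ^ (2n) ε` in the abelianization, so
the symbol of the bracket is zero. -/
theorem lie_mk_c (u : HH1 k (SuperJordanPlane k)) : ⁅HH1.mk (c k), u⁆ = 0 := by
  induction u using HH1_induction with
  | hc => exact lie_self _
  | hs n =>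
    rw [HH1.mk_lie_mk]
    refine (mk_eq_of_symbol_eq (f := ⁅c k, s k n⁆) (g := 0) ?_).trans rfl
    rw [map_zero, symbol_apply, Z1_lie_apply, s_y, c_y, s_x, map_sub, abelianization_map_y_pow,
      symbol_c, map_smul, map_mul, abelianization_x, map_pow, abelianization_y,
      mul_comm DualNumber.eps, sub_eq_zero]
    push_cast
    rfl
  | add u v hu hv => rw [lie_add, hu, hv, add_zero]
  | smul t u hu => rw [lie_smul, hu, smul_zero]

/-- The symbol of the bracket is `((2n+1) - (2m+1)) y ^ (2(n+m)+1)`, by the power rule for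
derivations into a commutative algebra. -/
theorem lie_mk_s (m n : ℕ) : ⁅HH1.mk (s k m), HH1.mk (s k n)⁆ =
    (2 * ((n : k) - (m : k))) • HH1.mk (s k (n + m)) := by
  rw [HH1.mk_lie_mk]
  refine (mk_eq_of_symbol_eq (g := (2 * ((n : k) - (m : k))) • s k (n + m)) ?_).trans rfl
  rw [symbol_apply, Z1_lie_apply, s_y, s_y, map_sub, abelianization_map_y_pow,
    abelianization_map_y_pow, map_smul, symbol_s, symbol_s, symbol_s, ← TrivSqZeroExt.inl_pow,
    ← TrivSqZeroExt.inl_pow, ← TrivSqZeroExt.inl_pow, ← pow_add,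
    ← pow_add, show 2 * n + (2 * m + 1) = 2 * (n + m) + 1 by ring,
    show 2 * m + (2 * n + 1) = 2 * (n + m) + 1 by ring]
  push_cast
  module

variable (k) in
/-- The linear isomorphism `HH¹(A, A) → Vir⁺ ⊕ 𝔥` with `c ↦ C` and `sₘ ↦ 2ᵐ⁺¹ Lₘ`. -/
noncomputable def toVirasoro : HH1 k (SuperJordanPlane k) ≃ₗ[k] Virasoro.positiveBorel k :=
  (HH1Equiv k).symm.trans (Virasoro.positiveBorelEquiv k)

theorem toVirasoro_c : (toVirasoro k (HH1.mk (c k)) : Virasoro k) = Virasoro.C k := by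
  rw [← HH1Equiv_c, toVirasoro, LinearEquiv.trans_apply, LinearEquiv.symm_apply_apply,
    Virasoro.coe_positiveBorelEquiv, Virasoro.ofFinsupp_apply, map_zero, one_smul, add_zero]

theorem toVirasoro_s (n : ℕ) : (toVirasoro k (HH1.mk (s k n)) : Virasoro k) =
    (2 : k) ^ (n + 1) • Virasoro.L k (n : ℤ) := by
  rw [← HH1Equiv_s, toVirasoro, LinearEquiv.trans_apply, LinearEquiv.symm_apply_apply,
    Virasoro.coe_positiveBorelEquiv, Virasoro.ofFinsupp_apply, Finsupp.linearCombination_single,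
    one_smul, zero_smul, zero_add]

theorem toVirasoro_lie (u v : HH1 k (SuperJordanPlane k)) :
    toVirasoro k ⁅u, v⁆ = ⁅toVirasoro k u, toVirasoro k v⁆ := by
  have hc (v : HH1 k (SuperJordanPlane k)) :
      toVirasoro k ⁅HH1.mk (c k), v⁆ = ⁅toVirasoro k (HH1.mk (c k)), toVirasoro k v⁆ := by
    refine Subtype.ext ?_
    rw [lie_mk_c, map_zero, LieSubalgebra.coe_bracket, toVirasoro_c, ← lie_skew, Virasoro.lie_C,
      neg_zero]
    rfl
  induction u using HH1_induction with
  | hc => exact hc v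
  | add u u' hu hu' => rw [add_lie, map_add, map_add, add_lie, hu, hu']
  | smul t u hu => rw [smul_lie, map_smul, map_smul, smul_lie, hu]
  | hs m =>
    induction v using HH1_induction with
    | hc => rw [← lie_skew, map_neg, hc, lie_skew]
    | add v v' hv hv' => rw [lie_add, map_add, map_add, lie_add, hv, hv']
    | smul t v hv => rw [lie_smul, map_smul, map_smul, lie_smul, hv]
    | hs n =>
      refine Subtype.ext ?_
      rw [lie_mk_s, map_smul, LieSubalgebra.coe_bracket, toVirasoro_s, toVirasoro_s,
        Virasoro.lie_two_pow_smul_L]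
      exact congrArg ((2 * ((n : k) - (m : k))) • ·) (toVirasoro_s (n + m))

end Cohomology

end SuperJordanPlane

theorem mainTheorem1 (k : Type*) [Field k] [CharZero k] :
    ∃ (c : Hochschild.Z1 k (SuperJordanPlane k)) (s : ℕ → Hochschild.Z1 k (SuperJordanPlane k)),
      (∀ f : Hochschild.Z1 k (SuperJordanPlane k),
        f = c ↔ f.1 (SuperJordanPlane.x k) = 0 ∧
          f.1 (SuperJordanPlane.y k) = SuperJordanPlane.x k) ∧
      (∀ (n : ℕ) (f : Hochschild.Z1 k (SuperJordanPlane k)),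
        f = s n ↔
          f.1 (SuperJordanPlane.x k) =
            (2 * (n : k) + 1) • (SuperJordanPlane.x k * SuperJordanPlane.y k ^ (2 * n)) ∧
          f.1 (SuperJordanPlane.y k) = SuperJordanPlane.y k ^ (2 * n + 1)) ∧
      (∀ z : Hochschild.HH1 k (SuperJordanPlane k), ⁅Hochschild.HH1.mk c, z⁆ = 0) ∧
      (∀ m n : ℕ, ⁅Hochschild.HH1.mk (s m), Hochschild.HH1.mk (s n)⁆ =
        (2 * ((n : k) - (m : k))) • Hochschild.HH1.mk (s (n + m))) ∧
      ∃ e : Hochschild.HH1 k (SuperJordanPlane k) ≃ₗ⁅k⁆ Virasoro.positiveBorel k,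
        (e (Hochschild.HH1.mk c) : Virasoro k) = Virasoro.C k ∧
        ∀ m : ℕ, (e (Hochschild.HH1.mk (s m)) : Virasoro k) =
          (2 : k) ^ (m + 1) • Virasoro.L k (m : ℤ) := by
  refine ⟨SuperJordanPlane.c k, SuperJordanPlane.s k, fun f => ⟨?_, fun h => ?_⟩,
    fun n f => ⟨?_, fun h => ?_⟩, SuperJordanPlane.lie_mk_c, SuperJordanPlane.lie_mk_s,
    { SuperJordanPlane.toVirasoro k with
      map_lie' := SuperJordanPlane.toVirasoro_lie _ _ },
    SuperJordanPlane.toVirasoro_c, SuperJordanPlane.toVirasoro_s⟩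
  · rintro rfl
    exact ⟨SuperJordanPlane.c_x k, SuperJordanPlane.c_y k⟩
  · exact SuperJordanPlane.Z1_ext (h.1.trans (SuperJordanPlane.c_x k).symm)
      (h.2.trans (SuperJordanPlane.c_y k).symm)
  · rintro rfl
    exact ⟨SuperJordanPlane.s_x k n, SuperJordanPlane.s_y k n⟩
  · exact SuperJordanPlane.Z1_ext (h.1.trans (SuperJordanPlane.s_x k n).symm)
      (h.2.trans (SuperJordanPlane.s_y k n).symm)
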